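/- Let $d\in\{2,3\}$, let $\Omega,B\subset\mathbb{R}^d$ be bounded domains (nonempty, open, connected) with Lipschitz boundaries and $\overline{B}\subset\Omega$, and put $\Gamma=\partial\Omega$, $D=\Omega\setminus\overline{B}$. Let $H^{1/2}(\Gamma;\mathbb{R}^d)$ be the image of the trace operator $H^1(\Omega;\mathbb{R}^d)\to L^2(\Gamma;\mathbb{R}^d)$, with its usual norm $$\|\mathbf g\|_{H^{1/2}}=\inf\{\|\mathbf u\|_{H^1(\Omega;\mathbb{R}^d)} : \mathbf u|_\Gamma=\mathbf g\},$$ and let $H^{-1/2}(\Gamma;\mathbb{R}^d)$ be its topological dual with the dual norm; the duality pairing, which extends the inner product of $L^2(\Gamma;\mathbb{R}^d)$, is written $(\cdot,\cdot)_{L^2(\Gamma)}$. For every $\mathbf g\in H^{1/2}(\Gamma;\mathbb{R}^d)$ the problem $$-\Delta\mathbf v=\mathbf 0\ \text{ in } D,\qquad \mathbf v=\mathbf 0\ \text{ on }\partial B,\qquad \mathbf v=\mathbf g\ \text{ on }\Gamma$$ has exactly one weak solution $\mathbf v=\mathbf v(\mathbf g)\in H^1(D;\mathbb{R}^d)$,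 that is, exactly one $\mathbf v\in H^1(D;\mathbb{R}^d)$ with these traces such that $\int_D\nabla\mathbf v:\nabla\boldsymbol\varphi\,dx=0$ for all $\boldsymbol\varphi\in H^1(D;\mathbb{R}^d)$ with zero trace on $\partial B$ and on $\Gamma$. Moreover, there is exactly one map $\Lambda:H^{1/2}(\Gamma;\mathbb{R}^d)\to H^{-1/2}(\Gamma;\mathbb{R}^d)$ (the Dirichlet-to-Neumann map $\mathbf g\mapsto\nabla\mathbf v(\mathbf g)\cdot\nu|_\Gamma$, the normal derivative being understood weakly) such that $$(\Lambda\mathbf g,\mathbf h)_{L^2(\Gamma)}=\int_D\nabla\mathbf v(\mathbf g):\nabla\mathbf w\,dx$$ for all $\mathbf g,\mathbf h\in H^{1/2}(\Gamma;\mathbb{R}^d)$ and all $\mathbf w\in H^1(D;\mathbb{R}^d)$ with trace $\mathbf 0$ on $\partial B$ and trace $\mathbf h$ on $\Gamma$. The form $(\mathbf g^1,\mathbf g^2)_\Lambda:=(\Lambda\mathbf g^1,\mathbf g^2)_{L^2(\Gamma)}$ is an inner product on $H^{1/2}(\Gamma;\mathbb{R}^d)$: it is bilinear, symmetric, and $(\mathbf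 g,\mathbf g)_\Lambda>0$ for $\mathbf g\neq\mathbf 0$. Its norm is equivalent to the usual norm: there are constants $c,C>0$ with $$c\,\|\mathbf g\|_{H^{1/2}}\le(\mathbf g,\mathbf g)_\Lambda^{1/2}\le C\,\|\mathbf g\|_{H^{1/2}}\qquad\text{for all }\mathbf g\in H^{1/2}(\Gamma;\mathbb{R}^d).$$ Finally, $\Lambda$ is an isomorphism (a linear bijection, continuous with continuous inverse) of $H^{1/2}(\Gamma;\mathbb{R}^d)$ onto $H^{-1/2}(\Gamma;\mathbb{R}^d)$. -/

import Mathlib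

open MeasureTheory Set Topology
open scoped ContDiff

noncomputable section

namespace DtN

/-- Euclidean space `ℝ^d`. -/
abbrev E (d : ℕ) : Type := EuclideanSpace ℝ (Fin d)

/-- The boundary of `U` is Lipschitz: near each of its points, after a rigid change of coordinates
(with vertical direction `n`), `U` is the set of points strictly above the graph of a Lipschitz
function. The function `η` is evaluated only on the hyperplane orthogonal to `n`. -/
def HasLipschitzBoundary {d : ℕ} (U : Set (E d)) : Prop :=
  ∀ x₀ ∈ frontier U, ∃ n : E d, ‖n‖ = 1 ∧ ∃ (K : NNReal) (η : E d → ℝ), LipschitzWith K η ∧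
    ∃ V ∈ 𝓝 x₀, ∀ x ∈ V, x ∈ U ↔ η (x - inner ℝ n x • n) < inner ℝ n x

/-- `L²(U; ℝ^d)` with respect to Lebesgue measure. -/
abbrev L2 {d : ℕ} (U : Set (E d)) : Type :=
  Lp (E d) 2 ((volume : Measure (E d)).restrict U)

/-- `L²(S; ℝ^d)` for a hypersurface `S`, with respect to the `(d-1)`-dimensional Hausdorff
measure. (Its normalization by a constant factor is irrelevant below: only convergence in
`L²(S; ℝ^d)` is used.) -/
abbrev L2Surf {d : ℕ} (S : Set (E d)) : Type :=
  Lp (E d) 2 ((Measure.hausdorffMeasure ((d : ℝ) - 1) : Measure (E d)).restrict S)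

/-- The `i`-th partial derivative of a differentiable function. -/
def partialDeriv {d : ℕ} {F : Type*} [NormedAddCommGroup F] [NormedSpace ℝ F]
    (i : Fin d) (φ : E d → F) (x : E d) : F :=
  fderiv ℝ φ x (EuclideanSpace.single i 1)

/-- `p ∈ L²(U; ℝ^d)` is the weak `i`-th partial derivative of `u ∈ L²(U; ℝ^d)` in `U`. -/
def IsWeakPartial {d : ℕ} {U : Set (E d)} (i : Fin d) (u p : L2 U) : Prop :=
  ∀ φ : E d → ℝ, ContDiff ℝ ∞ φ → HasCompactSupport φ → tsupport φ ⊆ U →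
    ∫ x in U, partialDeriv i φ x • u x = -∫ x in U, φ x • p x

theorem integrable_smul_L2 {d : ℕ} {U : Set (E d)} {φ : E d → ℝ} (hφ : Continuous φ)
    (hc : HasCompactSupport φ) (u : L2 U) :
    Integrable (fun x => φ x • u x) ((volume : Measure (E d)).restrict U) :=
  ((Lp.memLp u).locallyIntegrable (by norm_num)).integrable_smul_left_of_hasCompactSupport hφ hc

theorem continuous_partialDeriv {d : ℕ} {φ : E d → ℝ} (hφ : ContDiff ℝ ∞ φ) (i : Fin d) :
    Continuous (partialDeriv i φ) :=
  (hφ.continuous_fderiv (by simp)).clm_apply continuous_const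

theorem hasCompactSupport_partialDeriv {d : ℕ} {φ : E d → ℝ} (hc : HasCompactSupport φ)
    (i : Fin d) : HasCompactSupport (partialDeriv i φ) :=
  hc.fderiv_apply ℝ (EuclideanSpace.single i 1)

theorem IsWeakPartial.zero {d : ℕ} {U : Set (E d)} (i : Fin d) :
    IsWeakPartial i (0 : L2 U) 0 := by
  intro φ _ _ _
  have h := Lp.coeFn_zero (E d) 2 ((volume : Measure (E d)).restrict U)
  have h1 : ∫ x in U, partialDeriv i φ x • (0 : L2 U) x = 0 := by
    refine integral_eq_zero_of_ae ?_
    filter_upwards [h] with x hx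
    rw [hx, Pi.zero_apply, smul_zero]
  have h2 : ∫ x in U, φ x • (0 : L2 U) x = 0 := by
    refine integral_eq_zero_of_ae ?_
    filter_upwards [h] with x hx
    rw [hx, Pi.zero_apply, smul_zero]
  rw [h1, h2, neg_zero]

theorem IsWeakPartial.add {d : ℕ} {U : Set (E d)} {i : Fin d} {u p v q : L2 U}
    (hu : IsWeakPartial i u p) (hv : IsWeakPartial i v q) : IsWeakPartial i (u + v) (p + q) := by
  intro φ h1 h2 h3
  have key : ∀ (ψ : E d → ℝ), Continuous ψ → HasCompactSupport ψ → ∀ a b : L2 U,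
      ∫ x in U, ψ x • (a + b : L2 U) x = (∫ x in U, ψ x • a x) + ∫ x in U, ψ x • b x := by
    intro ψ hψ hψc a b
    rw [← integral_add (integrable_smul_L2 hψ hψc a) (integrable_smul_L2 hψ hψc b)]
    refine integral_congr_ae ?_
    filter_upwards [Lp.coeFn_add a b] with x hx
    rw [hx, Pi.add_apply, smul_add]
  rw [key _ (continuous_partialDeriv h1 i) (hasCompactSupport_partialDeriv h2 i),
    key _ h1.continuous h2, hu φ h1 h2 h3, hv φ h1 h2 h3, neg_add]

theorem IsWeakPartial.smul {d : ℕ} {U : Set (E d)} {i : Fin d} {u p : L2 U}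
    (c : ℝ) (hu : IsWeakPartial i u p) : IsWeakPartial i (c • u) (c • p) := by
  intro φ h1 h2 h3
  have key : ∀ (ψ : E d → ℝ) (a : L2 U),
      ∫ x in U, ψ x • (c • a : L2 U) x = c • ∫ x in U, ψ x • a x := by
    intro ψ a
    rw [← integral_smul]
    refine integral_congr_ae ?_
    filter_upwards [Lp.coeFn_smul c a] with x hx
    rw [hx, Pi.smul_apply, smul_comm]
  rw [key, key, hu φ h1 h2 h3, smul_neg]

/-- The Sobolev space `H¹(U; ℝ^d)`: pairs `(u, (∂₁u, …, ∂_d u))` of an `L²` function and its weak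
partial derivatives in `L²`, with the Hilbert norm
`‖u‖² = ‖u‖²_{L²} + ∑ i, ‖∂ᵢu‖²_{L²}`. -/
def H1 {d : ℕ} (U : Set (E d)) :
    Submodule ℝ (WithLp 2 (L2 U × PiLp 2 (fun _ : Fin d => L2 U))) where
  carrier := {u | ∀ i, IsWeakPartial i u.fst (u.snd i)}
  zero_mem' := fun i => IsWeakPartial.zero i
  add_mem' := fun hu hv i => (hu i).add (hv i)
  smul_mem' := fun c _ hu i => (hu i).smul c

/-- The function underlying an element of `H¹`. -/
def H1.toL2 {d : ℕ} {U : Set (E d)} (u : H1 U) : L2 U := u.1.fst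

/-- The weak partial derivative `∂ᵢu` of an element of `H¹`. -/
def H1.grad {d : ℕ} {U : Set (E d)} (u : H1 U) (i : Fin d) : L2 U := u.1.snd i

/-- `∫_U ∇v : ∇w dx`. -/
def dirichletForm {d : ℕ} {U : Set (E d)} (v w : H1 U) : ℝ :=
  ∫ x in U, ∑ i, inner ℝ (H1.grad v i x) (H1.grad w i x)

/-- The smooth `φ` on `ℝ^d` represents `u` in `H¹(U; ℝ^d)`, and its restriction to `S` represents
`g` in `L²(S; ℝ^d)`. -/
def IsSmoothTrace {d : ℕ} {U S : Set (E d)} (φ : E d → E d) (u : H1 U) (g : L2Surf S) : Prop :=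
  H1.toL2 u =ᵐ[(volume : Measure (E d)).restrict U] φ ∧
  (∀ i, H1.grad u i =ᵐ[(volume : Measure (E d)).restrict U] partialDeriv i φ) ∧
  g =ᵐ[(Measure.hausdorffMeasure ((d : ℝ) - 1) : Measure (E d)).restrict S] φ

/-- The graph of the restriction map `φ|_U ↦ φ|_S` on smooth compactly supported functions. -/
def smoothTraceGraph {d : ℕ} (U S : Set (E d)) : Submodule ℝ (H1 U × L2Surf S) where
  carrier := {p | ∃ φ : E d → E d, ContDiff ℝ ∞ φ ∧ HasCompactSupport φ ∧
    IsSmoothTrace φ p.1 p.2}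
  zero_mem' := by
    refine ⟨0, contDiff_const, HasCompactSupport.zero, Lp.coeFn_zero _ _ _, fun i => ?_,
      Lp.coeFn_zero _ _ _⟩
    filter_upwards [Lp.coeFn_zero (E d) 2 ((volume : Measure (E d)).restrict U)] with x hx
    have h0 : partialDeriv i (0 : E d → E d) x = 0 := by simp [partialDeriv]
    rw [h0]
    exact hx
  add_mem' := by
    rintro p q ⟨φ, h1, h2, h3, h4, h5⟩ ⟨ψ, k1, k2, k3, k4, k5⟩
    refine ⟨φ + ψ, h1.add k1, h2.add k2, ?_, fun i => ?_, ?_⟩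
    · exact (Lp.coeFn_add (H1.toL2 p.1) (H1.toL2 q.1)).trans (h3.add k3)
    · refine ((Lp.coeFn_add (H1.grad p.1 i) (H1.grad q.1 i)).trans ((h4 i).add (k4 i))).trans ?_
      refine Filter.Eventually.of_forall fun x => ?_
      simp only [partialDeriv, Pi.add_apply]
      rw [fderiv_add (h1.differentiable (by simp) x) (k1.differentiable (by simp) x)]
      rfl
    · exact (Lp.coeFn_add p.2 q.2).trans (h5.add k5)
  smul_mem' := by
    rintro c p ⟨φ, h1, h2, h3, h4, h5⟩
    refine ⟨c • φ, contDiff_const.smul h1, h2.mono (Function.support_const_smul_subset c φ),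
      ?_, fun i => ?_, ?_⟩
    · exact (Lp.coeFn_smul c (H1.toL2 p.1)).trans (h3.const_smul c)
    · refine ((Lp.coeFn_smul c (H1.grad p.1 i)).trans ((h4 i).const_smul c)).trans ?_
      refine Filter.Eventually.of_forall fun x => ?_
      simp only [partialDeriv, Pi.smul_apply]
      rw [fderiv_const_smul (h1.differentiable (by simp) x)]
      rfl
    · exact (Lp.coeFn_smul c p.2).trans (h5.const_smul c)

/-- The graph of the trace operator `H¹(U; ℝ^d) → L²(S; ℝ^d)`, the continuous extension of
`φ ↦ φ|_S` from smooth functions: the closure of the graph of the restriction map in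
`H¹(U; ℝ^d) × L²(S; ℝ^d)`. -/
def traceGraph {d : ℕ} (U S : Set (E d)) : Submodule ℝ (H1 U × L2Surf S) :=
  (smoothTraceGraph U S).topologicalClosure

/-- `g` is the trace of `u ∈ H¹(U; ℝ^d)` on `S`. -/
def HasTrace {d : ℕ} {U S : Set (E d)} (u : H1 U) (g : L2Surf S) : Prop :=
  (u, g) ∈ traceGraph U S

/-- The image of the trace operator `H¹(Ω; ℝ^d) → L²(∂Ω; ℝ^d)`. -/
def traceRange {d : ℕ} (Ω : Set (E d)) : Submodule ℝ (L2Surf (frontier Ω)) :=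
  (traceGraph Ω (frontier Ω)).map (LinearMap.snd ℝ (H1 Ω) (L2Surf (frontier Ω)))

/-- The space `H^{1/2}(Γ; ℝ^d)`, `Γ = ∂Ω`: the image of the trace operator on `H¹(Ω; ℝ^d)`. It is
normed below by `‖g‖ = inf {‖u‖_{H¹(Ω)} : u has trace g}`, not by the norm of `L²(Γ; ℝ^d)`. -/
def HHalf {d : ℕ} (Ω : Set (E d)) : Type := ↥(traceRange Ω)

instance {d : ℕ} (Ω : Set (E d)) : AddCommGroup (HHalf Ω) :=
  inferInstanceAs (AddCommGroup ↥(traceRange Ω))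

instance {d : ℕ} (Ω : Set (E d)) : Module ℝ (HHalf Ω) :=
  inferInstanceAs (Module ℝ ↥(traceRange Ω))

/-- The function in `L²(Γ; ℝ^d)` underlying an element of `H^{1/2}(Γ; ℝ^d)`. -/
def HHalf.toL2 {d : ℕ} {Ω : Set (E d)} (g : HHalf Ω) : L2Surf (frontier Ω) :=
  Subtype.val (p := fun g => g ∈ traceRange Ω) g

theorem HHalf.exists_lift {d : ℕ} {Ω : Set (E d)} (g : HHalf Ω) :
    ∃ u : H1 Ω, HasTrace u g.toL2 := by
  obtain ⟨p, hp, hpg⟩ := (Subtype.property (p := fun g => g ∈ traceRange Ω) g)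
  refine ⟨p.1, ?_⟩
  have h : p.2 = g.toL2 := hpg
  rw [← h]
  exact hp

/-- The norm `‖g‖ = inf {‖u‖_{H¹(Ω)} : u has trace g}`. -/
instance {d : ℕ} (Ω : Set (E d)) : Norm (HHalf Ω) :=
  ⟨fun g => sInf {r : ℝ | ∃ u : H1 Ω, HasTrace u g.toL2 ∧ ‖u‖ = r}⟩

theorem HHalf.norm_def {d : ℕ} {Ω : Set (E d)} (g : HHalf Ω) :
    ‖g‖ = sInf {r : ℝ | ∃ u : H1 Ω, HasTrace u g.toL2 ∧ ‖u‖ = r} := rfl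

theorem HHalf.norm_nonneg' {d : ℕ} {Ω : Set (E d)} (g : HHalf Ω) : 0 ≤ ‖g‖ := by
  refine Real.sInf_nonneg ?_
  rintro r ⟨u, -, rfl⟩
  exact norm_nonneg u

theorem HHalf.norm_le_of_hasTrace {d : ℕ} {Ω : Set (E d)} {g : HHalf Ω} {u : H1 Ω}
    (h : HasTrace u g.toL2) : ‖g‖ ≤ ‖u‖ := by
  refine csInf_le ⟨0, ?_⟩ ⟨u, h, rfl⟩
  rintro r ⟨v, -, rfl⟩
  exact norm_nonneg v

theorem HHalf.exists_lt {d : ℕ} {Ω : Set (E d)} (g : HHalf Ω) {r : ℝ} (hr : ‖g‖ < r) :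
    ∃ u : H1 Ω, HasTrace u g.toL2 ∧ ‖u‖ < r := by
  obtain ⟨u₀, hu₀⟩ := g.exists_lift
  obtain ⟨_, ⟨u, hu, rfl⟩, h⟩ := exists_lt_of_csInf_lt
    (s := {r : ℝ | ∃ u : H1 Ω, HasTrace u g.toL2 ∧ ‖u‖ = r}) ⟨‖u₀‖, u₀, hu₀, rfl⟩ hr
  exact ⟨u, hu, h⟩

theorem HHalf.norm_smul_le' {d : ℕ} {Ω : Set (E d)} (c : ℝ) (g : HHalf Ω) :
    ‖c • g‖ ≤ |c| * ‖g‖ := by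
  refine le_of_forall_pos_le_add fun ε hε => ?_
  have hc : (0 : ℝ) < |c| + 1 := by positivity
  obtain ⟨u, hu, hlt⟩ := g.exists_lt (lt_add_of_pos_right ‖g‖ (div_pos hε hc))
  have h : HasTrace (c • u) (c • g).toL2 := (traceGraph Ω (frontier Ω)).smul_mem c hu
  calc ‖c • g‖ ≤ ‖c • u‖ := HHalf.norm_le_of_hasTrace h
    _ = |c| * ‖u‖ := by rw [norm_smul, Real.norm_eq_abs]
    _ ≤ |c| * (‖g‖ + ε / (|c| + 1)) := by gcongr
    _ = |c| * ‖g‖ + |c| / (|c| + 1) * ε := by ring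
    _ ≤ |c| * ‖g‖ + ε := by
      have : |c| / (|c| + 1) ≤ 1 := (div_le_one hc).2 (by linarith)
      nlinarith

theorem HHalf.seminormCore {d : ℕ} (Ω : Set (E d)) : SeminormedSpace.Core ℝ (HHalf Ω) where
  norm_nonneg := HHalf.norm_nonneg'
  norm_smul c g := by
    refine le_antisymm (HHalf.norm_smul_le' c g) ?_
    rcases eq_or_ne c 0 with rfl | hc
    · simpa using HHalf.norm_nonneg' _
    · have h := HHalf.norm_smul_le' c⁻¹ (c • g)
      rw [inv_smul_smul₀ hc, abs_inv] at h
      have hc' : 0 < |c| := abs_pos.2 hc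
      rwa [inv_mul_eq_div, le_div_iff₀ hc', mul_comm] at h
  norm_triangle g h := by
    refine le_of_forall_pos_le_add fun ε hε => ?_
    obtain ⟨u, hu, h1⟩ := g.exists_lt (lt_add_of_pos_right ‖g‖ (half_pos hε))
    obtain ⟨v, hv, h2⟩ := h.exists_lt (lt_add_of_pos_right ‖h‖ (half_pos hε))
    have huv : HasTrace (u + v) (g + h).toL2 := (traceGraph Ω (frontier Ω)).add_mem hu hv
    have := (HHalf.norm_le_of_hasTrace huv).trans (norm_add_le u v)
    linarith

instance {d : ℕ} (Ω : Set (E d)) : SeminormedAddCommGroup (HHalf Ω) :=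
  SeminormedAddCommGroup.ofCore (HHalf.seminormCore Ω)

instance {d : ℕ} (Ω : Set (E d)) : NormedSpace ℝ (HHalf Ω) where
  norm_smul_le c g := ((HHalf.seminormCore Ω).norm_smul c g).le

/-- `H^{-1/2}(Γ; ℝ^d)`: the topological dual of `H^{1/2}(Γ; ℝ^d)`, with the dual norm. -/
abbrev HMinusHalf {d : ℕ} (Ω : Set (E d)) : Type := StrongDual ℝ (HHalf Ω)

/-- The annular region `Ω \ closure B`. -/
abbrev annular {d : ℕ} (Ω B : Set (E d)) : Set (E d) := Ω \ closure B

/-- `v ∈ H¹(Ω \ closure B; ℝ^d)` is the weak solution of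
`-Δv = 0` in `Ω \ closure B`, `v = 0` on `∂B`, `v = g` on `Γ = ∂Ω`. -/
def IsDirichletSolution {d : ℕ} {Ω B : Set (E d)} (g : HHalf Ω) (v : H1 (annular Ω B)) : Prop :=
  HasTrace v (0 : L2Surf (frontier B)) ∧ HasTrace v g.toL2 ∧
  ∀ φ : H1 (annular Ω B), HasTrace φ (0 : L2Surf (frontier B)) →
    HasTrace φ (0 : L2Surf (frontier Ω)) → dirichletForm v φ = 0

/-- `Λ` is the Dirichlet-to-Neumann map `g ↦ ∇v · ν` on `Γ`, where `v` is the solution of the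
Dirichlet problem with datum `g`. The normal derivative is the usual weak one, given by Green's
formula: `⟨Λg, h⟩ = ∫ ∇v : ∇w dx` for every `w ∈ H¹(Ω \ closure B; ℝ^d)` with `w = 0` on `∂B`
and `w = h` on `Γ`. -/
def IsDirichletToNeumann {d : ℕ} (Ω B : Set (E d)) (Λ : HHalf Ω → HMinusHalf Ω) : Prop :=
  ∀ (g : HHalf Ω) (v : H1 (annular Ω B)), IsDirichletSolution g v →
    ∀ (h : HHalf Ω) (w : H1 (annular Ω B)), HasTrace w (0 : L2Surf (frontier B)) →
      HasTrace w h.toL2 → Λ g h = dirichletForm v w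

end DtN

end

/-!
# The Dirichlet-to-Neumann map as an inner product

Write `D = Ω \ closure B`. Sending `g` to the solution `v(g)` of the Dirichlet problem identifies
`H^{1/2}(∂Ω)` with a closed subspace of `H¹(D)`, on which the Dirichlet form is an inner product
equivalent to that of `H¹`; the map `Λ` is then the Riesz isomorphism of this Hilbert space. This
rests on four facts, collected in `AnnularEstimates`.

* The Poincaré inequality for functions vanishing on `∂B` (`exists_norm_sq_le_dirichletForm`).
* The trace inequality on `∂Ω` (`exists_norm_trace_le`). It makes the trace single-valued, so that
  `v(g) = 0` forces `g = 0`, and it makes the space of solutions closed.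
* The bounded passage from `H¹(Ω)` to functions in `H¹(D)` vanishing on `∂B`, and back, with the
  same trace on `∂Ω`; both are multiplications by a cut-off function (`exists_hasTrace_cutoff`).
  Consequently the `H^{1/2}` norm, defined through extensions to `Ω`, is comparable to the energy
  of `v(g)`.

A function with a trace is by definition a limit of smooth functions, so that the inequalities need
to be proved for smooth functions only, as inequalities between extended nonnegative integrals.
Three elementary tools suffice.

* Along a segment, the change of a function is controlled by the integral of its gradient. Hence
  the `L²` norms on a set and on a translate of it are comparable up to the `L²` norm of the
  gradient (`lintegral_sq_le_translate`).
* The coordinates `(y, s) ↦ y + (η y + σ s) n` straighten a Lipschitz graph and preserve volume up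
  to a constant factor, being a shear followed by a linear isomorphism. Integrating along vertical
  segments compares the integral over the graph with the integral over a collar on one side of it
  (`exists_lintegral_graph_le`, `exists_lintegral_collar_le`).
* The parametrization of a Lipschitz graph is Lipschitz and its inverse is a contraction, so that
  Hausdorff measure on the graph and on the hyperplane are comparable
  (`setLIntegral_graph_le`, `setLIntegral_hyperplane_le`). No area formula is needed.

The trace inequality follows by covering `∂Ω` with finitely many charts. For the Poincaré inequality
call a point controlled if it has a neighbourhood on which the `L²` norm is bounded in terms of the
gradient on `D` and of the values on `∂B`. Points of `∂B` are controlled by the collar estimate, and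
control propagates by translation, so that the controlled points of `D` together with `closure B`
form an open and closed subset of the connected set `Ω`; this argument does not require `D` to be
connected. Points of `∂Ω` are reached by one more translation, and compactness of `closure Ω`
concludes (`isControlled_of_mem_closure`, `exists_poincare_le`).
-/

namespace DtN

open scoped ENNReal NNReal

section

/-! ### Differences of smooth functions along segments -/

/-- The squared length `∑ i, |∂ᵢφ|²` of the gradient, as an extended nonnegative function. -/
noncomputable def gradSq {d : ℕ} (φ : E d → E d) (x : E d) : ℝ≥0∞ :=
  ∑ i, ‖partialDeriv i φ x‖ₑ ^ 2

theorem continuous_gradSq {d : ℕ} {φ : E d → E d} (hφ : ContDiff ℝ ∞ φ) :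
    Continuous (gradSq φ) := by
  unfold gradSq
  refine continuous_finsetSum _ fun i _ => ?_
  have : Continuous (partialDeriv i φ) :=
    (hφ.continuous_fderiv (by simp)).clm_apply continuous_const
  exact (ENNReal.continuous_pow 2).comp this.enorm

theorem enorm_add_sq_le {F : Type*} [SeminormedAddCommGroup F] (a b : F) :
    ‖a + b‖ₑ ^ 2 ≤ 2 * ‖a‖ₑ ^ 2 + 2 * ‖b‖ₑ ^ 2 := by
  have h : (‖a + b‖₊ : ℝ≥0) ^ 2 ≤ 2 * ‖a‖₊ ^ 2 + 2 * ‖b‖₊ ^ 2 := by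
    rw [← NNReal.coe_le_coe]
    push_cast
    have := norm_add_le a b
    have h0 := norm_nonneg (a + b)
    nlinarith [sq_nonneg (‖a‖ - ‖b‖)]
  simp only [enorm_eq_nnnorm]
  exact_mod_cast h

theorem enorm_sq_le_of_sub {F : Type*} [SeminormedAddCommGroup F] (a b : F) :
    ‖a‖ₑ ^ 2 ≤ 2 * ‖b‖ₑ ^ 2 + 2 * ‖a - b‖ₑ ^ 2 := by
  simpa using enorm_add_sq_le b (a - b)

theorem enorm_fderiv_apply_sq_le {d : ℕ} (φ : E d → E d) (x m : E d) :
    ‖fderiv ℝ φ x m‖ₑ ^ 2 ≤ ‖m‖ₑ ^ 2 * gradSq φ x := by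
  have hm : m = ∑ i, m i • EuclideanSpace.single i (1 : ℝ) := by
    conv_lhs => rw [← (EuclideanSpace.basisFun (Fin d) ℝ).sum_repr m]
    simp
  have h1 : ‖fderiv ℝ φ x m‖ ≤ ∑ i, ‖m i‖ * ‖partialDeriv i φ x‖ := by
    conv_lhs => rw [hm, map_sum]
    refine (norm_sum_le _ _).trans (Finset.sum_le_sum fun i _ => ?_)
    rw [map_smul, norm_smul]
    rfl
  have h2 : ‖fderiv ℝ φ x m‖ ^ 2 ≤ ‖m‖ ^ 2 * ∑ i, ‖partialDeriv i φ x‖ ^ 2 := by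
    rw [EuclideanSpace.norm_sq_eq m]
    exact (pow_le_pow_left₀ (norm_nonneg _) h1 2).trans
      (Finset.sum_mul_sq_le_sq_mul_sq _ _ _)
  have h3 : (‖fderiv ℝ φ x m‖₊ : ℝ≥0) ^ 2 ≤ ‖m‖₊ ^ 2 * ∑ i, ‖partialDeriv i φ x‖₊ ^ 2 := by
    rw [← NNReal.coe_le_coe]
    push_cast
    exact h2
  unfold gradSq
  simp only [enorm_eq_nnnorm]
  exact_mod_cast h3

theorem lintegral_sq_le {α : Type*} [MeasurableSpace α] (μ : Measure α) {f : α → ℝ≥0∞}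
    (hf : AEMeasurable f μ) : (∫⁻ a, f a ∂μ) ^ 2 ≤ μ univ * ∫⁻ a, f a ^ 2 ∂μ := by
  have h := ENNReal.lintegral_mul_le_Lp_mul_Lq μ Real.HolderConjugate.two_two
    (aemeasurable_const (b := (1 : ℝ≥0∞))) hf
  simp only [Pi.mul_apply, one_mul, ENNReal.one_rpow, lintegral_const] at h
  have h2 := pow_le_pow_left₀ (zero_le) h 2
  refine h2.trans (le_of_eq ?_)
  rw [mul_pow, ← ENNReal.rpow_natCast, ← ENNReal.rpow_natCast, ← ENNReal.rpow_mul,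
    ← ENNReal.rpow_mul]
  norm_num

/-- The fundamental theorem of calculus along a segment, followed by the Cauchy–Schwarz
inequality. -/
theorem enorm_sub_sq_le_lintegral_gradSq {d : ℕ} {φ : E d → E d} (hφ : ContDiff ℝ ∞ φ)
    (x m : E d) {t : ℝ} (ht : 0 ≤ t) :
    ‖φ (x + t • m) - φ x‖ₑ ^ 2 ≤
      ENNReal.ofReal t * (‖m‖ₑ ^ 2 * ∫⁻ s in Ioc 0 t, gradSq φ (x + s • m)) := by
  have hline : ∀ s : ℝ, HasDerivAt (fun s : ℝ => x + s • m) m s := fun s => by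
    simpa using ((hasDerivAt_id s).smul_const m).const_add x
  have hd : ∀ s : ℝ, HasDerivAt (fun s : ℝ => φ (x + s • m)) (fderiv ℝ φ (x + s • m) m) s :=
    fun s => ((hφ.differentiable (by simp)) _).hasFDerivAt.comp_hasDerivAt s (hline s)
  have hc : Continuous fun s : ℝ => fderiv ℝ φ (x + s • m) m :=
    ((hφ.continuous_fderiv (by simp)).comp (by fun_prop)).clm_apply continuous_const
  have hI := intervalIntegral.integral_eq_sub_of_hasDerivAt (fun s _ => hd s)
    (hc.intervalIntegrable 0 t)
  rw [zero_smul, add_zero, intervalIntegral.integral_of_le ht] at hI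
  rw [← hI]
  calc ‖∫ s in Ioc 0 t, fderiv ℝ φ (x + s • m) m‖ₑ ^ 2
      ≤ (∫⁻ s in Ioc 0 t, ‖fderiv ℝ φ (x + s • m) m‖ₑ) ^ 2 :=
        pow_le_pow_left₀ (zero_le) (enorm_integral_le_lintegral_enorm _) 2
    _ ≤ (volume.restrict (Ioc 0 t)) univ *
          ∫⁻ s in Ioc 0 t, ‖fderiv ℝ φ (x + s • m) m‖ₑ ^ 2 :=
        lintegral_sq_le _ hc.enorm.aemeasurable
    _ ≤ _ := by
      rw [Measure.restrict_apply_univ, Real.volume_Ioc, sub_zero,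
        ← lintegral_const_mul (‖m‖ₑ ^ 2) (f := fun s : ℝ => gradSq φ (x + s • m))
          (((continuous_gradSq hφ).comp (by fun_prop)).measurable)]
      gcongr with s
      exact enorm_fderiv_apply_sq_le φ _ m

/-- Comparison of the `L²` norms of `φ` on `A` and on `A + h`, when the segments from `A` to
`A + h` stay in `D`. -/
theorem lintegral_sq_le_translate {d : ℕ} {φ : E d → E d} (hφ : ContDiff ℝ ∞ φ)
    {A A' D : Set (E d)} (hA' : MeasurableSet A') (hD : MeasurableSet D)
    {h : E d} (hAA' : ∀ x ∈ A, x + h ∈ A') (hAD : ∀ x ∈ A, ∀ s ∈ Ioc (0 : ℝ) 1, x + s • h ∈ D) :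
    ∫⁻ x in A, ‖φ x‖ₑ ^ 2 ≤
      2 * (∫⁻ x in A', ‖φ x‖ₑ ^ 2) + 2 * ‖h‖ₑ ^ 2 * ∫⁻ x in D, gradSq φ x := by
  have hG := continuous_gradSq hφ
  have shift : ∀ (f : E d → ℝ≥0∞) (_ : Continuous f) (k : E d) (D : Set (E d))
      (_ : MeasurableSet D) (_ : ∀ x ∈ A, x + k ∈ D),
      ∫⁻ x in A, f (x + k) ≤ ∫⁻ x in D, f x := by
    intro f hf k D hD hk
    rw [← (measurePreserving_add_right volume k).setLIntegral_comp_preimage hD hf.measurable]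
    exact lintegral_mono_set hk
  have hpt : ∀ x, ‖φ x‖ₑ ^ 2 ≤ 2 * ‖φ (x + h)‖ₑ ^ 2 +
      2 * ‖h‖ₑ ^ 2 * ∫⁻ s in Ioc (0 : ℝ) 1, gradSq φ (x + s • h) := by
    intro x
    have h1 := enorm_sq_le_of_sub (φ x) (φ (x + h))
    have h2 := enorm_sub_sq_le_lintegral_gradSq hφ x h zero_le_one
    rw [one_smul, ENNReal.ofReal_one, one_mul, ← enorm_neg, neg_sub] at h2
    rw [mul_assoc]
    exact h1.trans (by gcongr)
  have hcont : Continuous fun p : E d × ℝ => gradSq φ (p.1 + p.2 • h) := hG.comp (by fun_prop)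
  calc ∫⁻ x in A, ‖φ x‖ₑ ^ 2
      ≤ ∫⁻ x in A, (2 * ‖φ (x + h)‖ₑ ^ 2 +
          2 * ‖h‖ₑ ^ 2 * ∫⁻ s in Ioc (0 : ℝ) 1, gradSq φ (x + s • h)) := lintegral_mono hpt
    _ = 2 * (∫⁻ x in A, ‖φ (x + h)‖ₑ ^ 2) + 2 * ‖h‖ₑ ^ 2 *
          ∫⁻ x in A, ∫⁻ s in Ioc (0 : ℝ) 1, gradSq φ (x + s • h) := by
      have hm : Measurable fun x => ‖φ (x + h)‖ₑ ^ 2 :=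
        (hφ.continuous.comp
          (by fun_prop : Continuous fun x => x + h)).enorm.measurable.pow_const 2
      rw [lintegral_add_left (hm.const_mul 2), lintegral_const_mul _ hm, lintegral_const_mul]
      exact hcont.measurable.lintegral_prod_right'
    _ ≤ _ := by
      refine add_le_add (mul_le_mul_right ?_ _) (mul_le_mul_right ?_ _)
      · exact shift (fun x => ‖φ x‖ₑ ^ 2)
          ((ENNReal.continuous_pow 2).comp hφ.continuous.enorm) h A' hA' hAA'
      · rw [lintegral_lintegral_swap (f := fun x s => gradSq φ (x + s • h))
          hcont.measurable.aemeasurable]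
        calc ∫⁻ s in Ioc (0 : ℝ) 1, ∫⁻ x in A, gradSq φ (x + s • h)
            ≤ ∫⁻ s in Ioc (0 : ℝ) 1, ∫⁻ x in D, gradSq φ x :=
              setLIntegral_mono measurable_const fun s hs =>
                shift _ hG (s • h) D hD fun x hx => hAD x hx s hs
          _ = _ := by simp

end

section

/-! ### Graph coordinates -/

/-- The hyperplane orthogonal to `n`. -/
abbrev Hyperplane {d : ℕ} (n : E d) : Type := ↥(ℝ ∙ n)ᗮ

/-- Orthogonal projection onto the hyperplane orthogonal to `n`. -/
noncomputable abbrev hproj {d : ℕ} (n : E d) : E d →L[ℝ] Hyperplane n :=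
  (ℝ ∙ n)ᗮ.orthogonalProjectionOnto

/-- `(d-1)`-dimensional Hausdorff measure on the hyperplane orthogonal to `n`. -/
noncomputable abbrev hmeas {d : ℕ} (n : E d) : Measure (Hyperplane n) :=
  Measure.hausdorffMeasure ((d : ℝ) - 1)

/-- `(d-1)`-dimensional Hausdorff measure on `ℝ^d`. -/
noncomputable abbrev surf (d : ℕ) : Measure (E d) :=
  Measure.hausdorffMeasure ((d : ℝ) - 1)

/-- Coordinates straightening the graph of `η` over the hyperplane orthogonal to `n`: the point
`(y, s)` is sent to the point over `y` at signed height `σ s` from the graph. -/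
noncomputable def graphChart {d : ℕ} (n : E d) (η : E d → ℝ) (σ : ℝ) (p : Hyperplane n × ℝ) : E d :=
  p.1 + (η p.1 + σ * p.2) • n

/-- The signed vertical distance from `x` to the graph of `η`. -/
noncomputable def graphHeight {d : ℕ} (n : E d) (η : E d → ℝ) (x : E d) : ℝ :=
  inner ℝ n x - η (x - inner ℝ n x • n)

variable {d : ℕ} {n : E d} {η : E d → ℝ}

theorem inner_hyperplane (y : Hyperplane n) : inner ℝ n (y : E d) = 0 :=
  Submodule.mem_orthogonal_singleton_iff_inner_right.1 y.2

theorem coe_hproj (hn : ‖n‖ = 1) (x : E d) : (hproj n x : E d) = x - inner ℝ n x • n := by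
  rw [hproj, Submodule.coe_orthogonalProjectionOnto_apply, Submodule.starProjection_orthogonal_val,
    Submodule.starProjection_unit_singleton ℝ hn]

theorem hproj_add_smul (y : Hyperplane n) (t : ℝ) : hproj n ((y : E d) + t • n) = y := by
  have h : hproj n n = 0 :=
    Submodule.orthogonalProjectionOnto_apply_of_mem_orthogonal
      (Submodule.le_orthogonal_orthogonal _ (Submodule.mem_span_singleton_self n))
  rw [map_add, map_smul, h, smul_zero, add_zero,
    Submodule.orthogonalProjectionOnto_mem_subspace_eq_self]

theorem inner_add_smul (hn : ‖n‖ = 1) (y : Hyperplane n) (t : ℝ) :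
    inner ℝ n ((y : E d) + t • n) = t := by
  rw [inner_add_right, inner_hyperplane, inner_smul_right, real_inner_self_eq_norm_sq, hn]
  simp

theorem hproj_graphChart (σ : ℝ) (p : Hyperplane n × ℝ) : hproj n (graphChart n η σ p) = p.1 :=
  hproj_add_smul _ _

theorem graphHeight_graphChart (hn : ‖n‖ = 1) (σ : ℝ) (p : Hyperplane n × ℝ) :
    graphHeight n η (graphChart n η σ p) = σ * p.2 := by
  rw [graphHeight, ← coe_hproj hn, hproj_graphChart, graphChart, inner_add_smul hn]
  ring

theorem graphChart_hproj_graphHeight (hn : ‖n‖ = 1) {σ : ℝ} (hσ : σ * σ = 1) (x : E d) :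
    graphChart n η σ (hproj n x, σ * graphHeight n η x) = x := by
  rw [graphChart, ← mul_assoc, hσ, one_mul, graphHeight, ← coe_hproj hn]
  dsimp only
  rw [add_sub_cancel, coe_hproj hn, sub_add_cancel]

theorem continuous_graphHeight (hη : Continuous η) : Continuous (graphHeight n η) := by
  unfold graphHeight
  fun_prop

theorem continuous_graphChart (hη : Continuous η) (σ : ℝ) : Continuous (graphChart n η σ) := by
  unfold graphChart
  fun_prop

theorem graphHeight_add_smul (hn : ‖n‖ = 1) (x : E d) (t : ℝ) :
    graphHeight n η (x + t • n) = graphHeight n η x + t := by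
  have h : inner ℝ n (x + t • n) = inner ℝ n x + t := by
    rw [inner_add_right, inner_smul_right, real_inner_self_eq_norm_sq, hn]
    simp
  rw [graphHeight, graphHeight, h, add_smul, add_sub_add_right_eq_sub]
  ring

theorem finrank_hyperplane (hn : ‖n‖ = 1) :
    ((Module.finrank ℝ (Hyperplane n) : ℕ) : ℝ) = (d : ℝ) - 1 := by
  have hn0 : n ≠ 0 := by
    rintro rfl
    simp at hn
  have h := (ℝ ∙ n).finrank_add_finrank_orthogonal
  rw [finrank_span_singleton hn0, finrank_euclideanSpace_fin] at h
  have h' : (1 : ℝ) + Module.finrank ℝ (Hyperplane n) = d := mod_cast h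
  linarith

theorem isAddHaarMeasure_hmeas (hn : ‖n‖ = 1) : (hmeas n).IsAddHaarMeasure := by
  rw [hmeas, ← finrank_hyperplane hn]
  infer_instance

theorem zero_le_dim_sub_one (hn : ‖n‖ = 1) : (0 : ℝ) ≤ (d : ℝ) - 1 := by
  rw [← finrank_hyperplane hn]
  positivity

/-- The splitting of `ℝ^d` into the hyperplane orthogonal to `n` and the line through `n`. -/
noncomputable def hyperplaneProdEquiv (hn : ‖n‖ = 1) : (Hyperplane n × ℝ) ≃L[ℝ] E d :=
  LinearEquiv.toContinuousLinearEquiv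
    { toFun := fun p => (p.1 : E d) + p.2 • n
      map_add' := fun p q => by
        simp only [Prod.fst_add, Prod.snd_add, Submodule.coe_add, add_smul]
        abel
      map_smul' := fun c p => by simp [mul_smul]
      invFun := fun x => (hproj n x, inner ℝ n x)
      left_inv := fun p => by
        dsimp only
        rw [hproj_add_smul, inner_add_smul hn]
      right_inv := fun x => by
        dsimp only
        rw [coe_hproj hn, sub_add_cancel] }

/-- Graph coordinates preserve volume up to a constant factor: they are the composition of a shear,
which preserves the product measure, and a linear isomorphism, which sends a Haar measure to a
Haar measure. -/
theorem exists_map_graphChart (hn : ‖n‖ = 1) (hη : Continuous η) {σ : ℝ} (hσ : σ * σ = 1) :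
    ∃ c : ℝ≥0, 0 < c ∧
      Measure.map (graphChart n η σ) ((hmeas n).prod volume) = c • (volume : Measure (E d)) := by
  have := isAddHaarMeasure_hmeas hn
  set e := hyperplaneProdEquiv hn
  have hshear : MeasurePreserving (fun p : Hyperplane n × ℝ => (p.1, η p.1 + σ * p.2))
      ((hmeas n).prod volume) ((hmeas n).prod volume) := by
    refine (MeasurePreserving.id (hmeas n)).skew_product (g := fun y s => η y + σ * s) ?_ ?_
    · exact (by fun_prop : Continuous _).measurable
    · refine Filter.Eventually.of_forall fun y => ?_
      have h1 : Measure.map (fun s : ℝ => σ * s) volume = volume := by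
        have h0 : σ ≠ 0 := by
          rintro rfl
          simp at hσ
        rw [Real.map_volume_mul_left h0, abs_inv]
        have : |σ| = 1 := by
          rw [← sq_eq_sq₀ (abs_nonneg _) zero_le_one, sq_abs, sq, hσ, one_pow]
        simp [this]
      have h2 : (fun s : ℝ => η y + σ * s) = (fun s => η y + s) ∘ fun s => σ * s := rfl
      rw [h2, ← Measure.map_map (by fun_prop) (by fun_prop), h1, map_add_left_eq_self]
  have hcomp : graphChart n η σ = e ∘ fun p : Hyperplane n × ℝ => (p.1, η p.1 + σ * p.2) := rfl
  have hH : (Measure.map e ((hmeas n).prod volume)).IsAddHaarMeasure :=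
    e.isAddHaarMeasure_map _
  refine ⟨Measure.addHaarScalarFactor (Measure.map e ((hmeas n).prod volume)) volume,
    Measure.addHaarScalarFactor_pos_of_isAddHaarMeasure _ _, ?_⟩
  rw [hcomp, ← Measure.map_map e.continuous.measurable hshear.measurable, hshear.map_eq]
  exact Measure.isAddLeftInvariant_eq_smul _ _

/-- The parametrization of the graph of `η`. -/
noncomputable def graphMap (n : E d) (η : E d → ℝ) (y : Hyperplane n) : E d := y + η y • n

theorem graphChart_zero (σ : ℝ) (y : Hyperplane n) : graphChart n η σ (y, 0) = graphMap n η y := by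
  simp [graphChart, graphMap]

theorem lipschitzWith_graphMap (hn : ‖n‖ = 1) {K : ℝ≥0} (hη : LipschitzWith K η) :
    LipschitzWith (1 + K) (graphMap n η) := by
  refine LipschitzWith.add (LipschitzWith.subtype_val _) ?_
  refine LipschitzWith.of_dist_le_mul fun y z => ?_
  rw [dist_eq_norm, ← sub_smul, norm_smul, hn, mul_one, ← dist_eq_norm]
  exact hη.dist_le_mul _ _

theorem lipschitzWith_hproj : LipschitzWith 1 (hproj n) :=
  ((hproj n).lipschitz).weaken (Submodule.orthogonalProjectionOnto_norm_le _)

theorem hproj_graphMap (y : Hyperplane n) : hproj n (graphMap n η y) = y := hproj_add_smul _ _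

/-- The surface measure on a graph is controlled by the measure of the parameter domain, since
the parametrization is Lipschitz. -/
theorem setLIntegral_graph_le (hn : ‖n‖ = 1) {K : ℝ≥0} (hη : LipschitzWith K η)
    {A : Set (Hyperplane n)} {f : E d → ℝ≥0∞} (hf : Measurable f) :
    ∫⁻ x in graphMap n η '' A, f x ∂(surf d) ≤
      ((1 + K : ℝ≥0) : ℝ≥0∞) ^ ((d : ℝ) - 1) * ∫⁻ y in A, f (graphMap n η y) ∂(hmeas n) := by
  have hL := lipschitzWith_graphMap hn hη
  rw [← lintegral_map hf hL.continuous.measurable, ← smul_eq_mul,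
    ← lintegral_smul_measure]
  refine lintegral_mono' (Measure.le_iff.2 fun s hs => ?_) le_rfl
  rw [Measure.restrict_apply hs, Measure.smul_apply,
    Measure.map_apply hL.continuous.measurable hs,
    Measure.restrict_apply (hL.continuous.measurable hs), smul_eq_mul]
  rw [inter_comm s, inter_comm (_ ⁻¹' s), ← image_inter_preimage]
  exact hL.hausdorffMeasure_image_le (zero_le_dim_sub_one hn) _

/-- The measure of the parameter domain is controlled by the surface measure of the graph, since
the projection is a contraction. -/
theorem setLIntegral_hyperplane_le (hn : ‖n‖ = 1) {K : ℝ≥0} (hη : LipschitzWith K η)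
    {A : Set (Hyperplane n)} {f : E d → ℝ≥0∞} (hf : Measurable f) :
    ∫⁻ y in A, f (graphMap n η y) ∂(hmeas n) ≤ ∫⁻ x in graphMap n η '' A, f x ∂(surf d) := by
  have hL := lipschitzWith_graphMap hn hη
  rw [← lintegral_map hf hL.continuous.measurable]
  refine lintegral_mono' (Measure.le_iff.2 fun s hs => ?_) le_rfl
  rw [Measure.restrict_apply hs, Measure.map_apply hL.continuous.measurable hs,
    Measure.restrict_apply (hL.continuous.measurable hs)]
  rw [inter_comm s, inter_comm (_ ⁻¹' s), ← image_inter_preimage]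
  have h := (lipschitzWith_hproj (n := n)).hausdorffMeasure_image_le (zero_le_dim_sub_one hn)
    (graphMap n η '' (A ∩ graphMap n η ⁻¹' s))
  rw [image_image] at h
  simpa [hproj_graphMap] using h

end

section

variable {d : ℕ} {n : E d} {η : E d → ℝ}

/-! ### Estimates in a one-sided collar of a graph -/

theorem graphChart_eq_graphMap_add (σ : ℝ) (y : Hyperplane n) (s : ℝ) :
    graphChart n η σ (y, s) = graphMap n η y + s • σ • n := by
  rw [graphChart, graphMap, add_assoc, smul_smul, mul_comm s σ, ← add_smul]

theorem lintegral_graphChart_le {σ : ℝ} (hη : Continuous η) (hn : ‖n‖ = 1) {c : ℝ≥0}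
    (hc : Measure.map (graphChart n η σ) ((hmeas n).prod volume) = c • (volume : Measure (E d)))
    {A : Set (Hyperplane n)} {r : ℝ} {D : Set (E d)} (hD : MeasurableSet D)
    (hAD : ∀ y ∈ A, ∀ s ∈ Ioo 0 r, graphChart n η σ (y, s) ∈ D) {f : E d → ℝ≥0∞}
    (hf : Measurable f) :
    ∫⁻ y in A, (∫⁻ s in Ioo 0 r, f (graphChart n η σ (y, s))) ∂(hmeas n) ≤
      c * ∫⁻ x in D, f x := by
  have := isAddHaarMeasure_hmeas hn
  have hΨ := (continuous_graphChart (n := n) hη σ).measurable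
  rw [lintegral_lintegral (f := fun y s => f (graphChart n η σ (y, s)))
    (hf.comp hΨ).aemeasurable, Measure.prod_restrict]
  calc ∫⁻ z in A ×ˢ Ioo 0 r, f (graphChart n η σ (z.1, z.2)) ∂((hmeas n).prod volume)
      ≤ ∫⁻ z in graphChart n η σ ⁻¹' D, f (graphChart n η σ z) ∂((hmeas n).prod volume) :=
        lintegral_mono_set fun p hp => hAD p.1 hp.1 p.2 hp.2
    _ = ∫⁻ x in D, f x ∂(c • (volume : Measure (E d))) := by
        rw [← hc, setLIntegral_map hD hf hΨ]
    _ = c * ∫⁻ x in D, f x := by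
        rw [Measure.restrict_smul, lintegral_smul_measure]
        rfl

theorem le_lintegral_graphChart {σ : ℝ} (hη : Continuous η) (hn : ‖n‖ = 1) {c : ℝ≥0}
    (hc : Measure.map (graphChart n η σ) ((hmeas n).prod volume) = c • (volume : Measure (E d)))
    {A : Set (Hyperplane n)} {r : ℝ} {W : Set (E d)} (hW : MeasurableSet W)
    (hAW : ∀ y s, graphChart n η σ (y, s) ∈ W → y ∈ A ∧ s ∈ Ioo 0 r) {f : E d → ℝ≥0∞}
    (hf : Measurable f) :
    c * ∫⁻ x in W, f x ≤
      ∫⁻ y in A, (∫⁻ s in Ioo 0 r, f (graphChart n η σ (y, s))) ∂(hmeas n) := by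
  have := isAddHaarMeasure_hmeas hn
  have hΨ := (continuous_graphChart (n := n) hη σ).measurable
  rw [lintegral_lintegral (f := fun y s => f (graphChart n η σ (y, s)))
    (hf.comp hΨ).aemeasurable, Measure.prod_restrict]
  calc c * ∫⁻ x in W, f x
      = ∫⁻ x in W, f x ∂(c • (volume : Measure (E d))) := by
        rw [Measure.restrict_smul, lintegral_smul_measure]
        rfl
    _ = ∫⁻ z in graphChart n η σ ⁻¹' W, f (graphChart n η σ z) ∂((hmeas n).prod volume) := by
        rw [← hc, setLIntegral_map hW hf hΨ]
    _ ≤ ∫⁻ z in A ×ˢ Ioo 0 r, f (graphChart n η σ (z.1, z.2)) ∂((hmeas n).prod volume) :=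
        lintegral_mono_set fun p hp => hAW p.1 p.2 hp

theorem enorm_sub_sq_le_vertical (hn : ‖n‖ = 1) {σ : ℝ} (hσ : σ * σ = 1) {φ : E d → E d}
    (hφ : ContDiff ℝ ∞ φ) (y : Hyperplane n) {r t : ℝ} (ht : t ∈ Ioo 0 r) :
    ‖φ (graphChart n η σ (y, t)) - φ (graphMap n η y)‖ₑ ^ 2 ≤
      ENNReal.ofReal r * ∫⁻ s in Ioo 0 r, gradSq φ (graphChart n η σ (y, s)) := by
  have hm : ‖σ • n‖ₑ = 1 := by
    have : ‖σ‖ = 1 := by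
      rw [← sq_eq_sq₀ (norm_nonneg _) zero_le_one, Real.norm_eq_abs, sq_abs, sq, hσ, one_pow]
    rw [← ofReal_norm, norm_smul, this, hn]
    simp
  have h := enorm_sub_sq_le_lintegral_gradSq hφ (graphMap n η y) (σ • n) ht.1.le
  rw [hm, one_pow, one_mul] at h
  simp only [graphChart_eq_graphMap_add]
  refine h.trans (mul_le_mul' (ENNReal.ofReal_le_ofReal ht.2.le) (lintegral_mono_set ?_))
  exact fun s hs => ⟨hs.1, hs.2.trans_lt ht.2⟩

theorem le_inv_mul_of_mul_le {R C : ℝ≥0} (hR : R ≠ 0) {a b : ℝ≥0∞} (h : R * a ≤ C * b) :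
    a ≤ (R⁻¹ * C : ℝ≥0) * b := by
  have hR' : (R : ℝ≥0∞) ≠ 0 := by exact_mod_cast hR
  calc a = (R : ℝ≥0∞)⁻¹ * (R * a) := by
        rw [← mul_assoc, ENNReal.inv_mul_cancel hR' ENNReal.coe_ne_top, one_mul]
    _ ≤ (R : ℝ≥0∞)⁻¹ * (C * b) := by gcongr
    _ = _ := by rw [ENNReal.coe_mul, ENNReal.coe_inv hR, mul_assoc]

/-- Values on a graph are controlled by the values and the gradient on a collar. -/
theorem exists_lintegral_graph_le (hn : ‖n‖ = 1) (hη : Continuous η) {σ : ℝ} (hσ : σ * σ = 1)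
    {A : Set (Hyperplane n)} {r : ℝ} (hr : 0 < r) {D : Set (E d)}
    (hD : MeasurableSet D) (hAD : ∀ y ∈ A, ∀ s ∈ Ioo 0 r, graphChart n η σ (y, s) ∈ D) :
    ∃ C : ℝ≥0, ∀ φ : E d → E d, ContDiff ℝ ∞ φ →
      ∫⁻ y in A, ‖φ (graphMap n η y)‖ₑ ^ 2 ∂(hmeas n) ≤
        C * ((∫⁻ x in D, ‖φ x‖ₑ ^ 2) + ∫⁻ x in D, gradSq φ x) := by
  have := isAddHaarMeasure_hmeas hn
  obtain ⟨c, hc0, hc⟩ := exists_map_graphChart hn hη hσ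
  set R : ℝ≥0 := r.toNNReal with hR
  have hR0 : R ≠ 0 := by simpa [hR] using hr
  refine ⟨R⁻¹ * (2 * c + 2 * R ^ 2 * c), fun φ hφ => ?_⟩
  have hΨ := continuous_graphChart (n := n) hη σ
  have hf : Continuous fun x => ‖φ x‖ₑ ^ 2 := (ENNReal.continuous_pow 2).comp hφ.continuous.enorm
  have hG := continuous_gradSq hφ
  have hfΨ : Measurable fun y : Hyperplane n =>
      ∫⁻ s in Ioo 0 r, ‖φ (graphChart n η σ (y, s))‖ₑ ^ 2 :=
    (hf.comp hΨ).measurable.lintegral_prod_right'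
  have hGΨ : Measurable fun y : Hyperplane n =>
      ∫⁻ s in Ioo 0 r, gradSq φ (graphChart n η σ (y, s)) :=
    (hG.comp hΨ).measurable.lintegral_prod_right'
  have hpt : ∀ y : Hyperplane n, (R : ℝ≥0∞) * ‖φ (graphMap n η y)‖ₑ ^ 2 ≤
      2 * (∫⁻ s in Ioo 0 r, ‖φ (graphChart n η σ (y, s))‖ₑ ^ 2) +
        2 * (R : ℝ≥0∞) ^ 2 * ∫⁻ s in Ioo 0 r, gradSq φ (graphChart n η σ (y, s)) := by
    intro y
    calc (R : ℝ≥0∞) * ‖φ (graphMap n η y)‖ₑ ^ 2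
        = ∫⁻ _ in Ioo 0 r, ‖φ (graphMap n η y)‖ₑ ^ 2 := by
          rw [lintegral_const, Measure.restrict_apply_univ, Real.volume_Ioo, sub_zero, mul_comm]
          rfl
      _ ≤ ∫⁻ t in Ioo 0 r, (2 * ‖φ (graphChart n η σ (y, t))‖ₑ ^ 2 +
            2 * ((R : ℝ≥0∞) * ∫⁻ s in Ioo 0 r, gradSq φ (graphChart n η σ (y, s)))) := by
          refine setLIntegral_mono' measurableSet_Ioo fun t ht => ?_
          have h1 := enorm_sq_le_of_sub (φ (graphMap n η y)) (φ (graphChart n η σ (y, t)))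
          have h2 := enorm_sub_sq_le_vertical (η := η) hn hσ hφ y ht
          rw [← enorm_neg, neg_sub] at h2
          exact h1.trans (by gcongr; exact h2)
      _ = _ := by
          have hm : Measurable fun t : ℝ => ‖φ (graphChart n η σ (y, t))‖ₑ ^ 2 :=
            (hf.comp (hΨ.comp (by fun_prop : Continuous fun t : ℝ => (y, t)))).measurable
          rw [lintegral_add_left (hm.const_mul 2), lintegral_const_mul _ hm, lintegral_const,
            Measure.restrict_apply_univ, Real.volume_Ioo, sub_zero]
          have : ENNReal.ofReal r = R := rfl
          rw [this]
          ring
  have hmul : (R : ℝ≥0∞) * ∫⁻ y in A, ‖φ (graphMap n η y)‖ₑ ^ 2 ∂(hmeas n) ≤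
      2 * (c * ∫⁻ x in D, ‖φ x‖ₑ ^ 2) + 2 * (R : ℝ≥0∞) ^ 2 * (c * ∫⁻ x in D, gradSq φ x) := by
    rw [← lintegral_const_mul' _ _ ENNReal.coe_ne_top]
    refine (lintegral_mono hpt).trans ?_
    rw [lintegral_add_left (hfΨ.const_mul 2), lintegral_const_mul _ hfΨ, lintegral_const_mul _ hGΨ]
    gcongr
    · exact lintegral_graphChart_le hη hn hc hD hAD hf.measurable
    · exact lintegral_graphChart_le hη hn hc hD hAD hG.measurable
  refine le_inv_mul_of_mul_le hR0 (hmul.trans ?_)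
  push_cast
  calc _ ≤ 2 * (c * ∫⁻ x in D, ‖φ x‖ₑ ^ 2) + 2 * (R : ℝ≥0∞) ^ 2 * (c * ∫⁻ x in D, gradSq φ x) +
        (2 * (c * ∫⁻ x in D, gradSq φ x) + 2 * (R : ℝ≥0∞) ^ 2 * (c * ∫⁻ x in D, ‖φ x‖ₑ ^ 2)) :=
        le_self_add
    _ = _ := by ring

/-- Values in a collar are controlled by the values on the graph and the gradient. -/
theorem exists_lintegral_collar_le (hn : ‖n‖ = 1) (hη : Continuous η) {σ : ℝ} (hσ : σ * σ = 1)
    {A : Set (Hyperplane n)} {r : ℝ} {D W : Set (E d)}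
    (hD : MeasurableSet D) (hAD : ∀ y ∈ A, ∀ s ∈ Ioo 0 r, graphChart n η σ (y, s) ∈ D)
    (hW : MeasurableSet W) (hAW : ∀ y s, graphChart n η σ (y, s) ∈ W → y ∈ A ∧ s ∈ Ioo 0 r) :
    ∃ C : ℝ≥0, ∀ φ : E d → E d, ContDiff ℝ ∞ φ →
      ∫⁻ x in W, ‖φ x‖ₑ ^ 2 ≤
        C * ((∫⁻ x in D, gradSq φ x) + ∫⁻ y in A, ‖φ (graphMap n η y)‖ₑ ^ 2 ∂(hmeas n)) := by
  have := isAddHaarMeasure_hmeas hn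
  obtain ⟨c, hc0, hc⟩ := exists_map_graphChart hn hη hσ
  set R : ℝ≥0 := r.toNNReal with hR
  have hRr : ENNReal.ofReal r = R := rfl
  refine ⟨c⁻¹ * (2 * R + 2 * R ^ 2 * c), fun φ hφ => ?_⟩
  have hΨ := continuous_graphChart (n := n) hη σ
  have hf : Continuous fun x => ‖φ x‖ₑ ^ 2 := (ENNReal.continuous_pow 2).comp hφ.continuous.enorm
  have hG := continuous_gradSq hφ
  have hγ : Measurable fun y : Hyperplane n => ‖φ (graphMap n η y)‖ₑ ^ 2 :=
    (hf.comp (by unfold graphMap; fun_prop : Continuous (graphMap n η))).measurable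
  have hGΨ : Measurable fun y : Hyperplane n =>
      ∫⁻ s in Ioo 0 r, gradSq φ (graphChart n η σ (y, s)) :=
    (hG.comp hΨ).measurable.lintegral_prod_right'
  have hpt : ∀ y : Hyperplane n, ∫⁻ s in Ioo 0 r, ‖φ (graphChart n η σ (y, s))‖ₑ ^ 2 ≤
      2 * (R : ℝ≥0∞) * ‖φ (graphMap n η y)‖ₑ ^ 2 +
        2 * (R : ℝ≥0∞) ^ 2 * ∫⁻ s in Ioo 0 r, gradSq φ (graphChart n η σ (y, s)) := by
    intro y
    calc ∫⁻ s in Ioo 0 r, ‖φ (graphChart n η σ (y, s))‖ₑ ^ 2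
        ≤ ∫⁻ _ in Ioo 0 r, (2 * ‖φ (graphMap n η y)‖ₑ ^ 2 +
            2 * ((R : ℝ≥0∞) * ∫⁻ s in Ioo 0 r, gradSq φ (graphChart n η σ (y, s)))) := by
          refine setLIntegral_mono' measurableSet_Ioo fun t ht => ?_
          have h1 := enorm_sq_le_of_sub (φ (graphChart n η σ (y, t))) (φ (graphMap n η y))
          have h2 := enorm_sub_sq_le_vertical (η := η) hn hσ hφ y ht
          exact h1.trans (by gcongr; exact h2)
      _ = _ := by
          rw [lintegral_const, Measure.restrict_apply_univ, Real.volume_Ioo, sub_zero, hRr]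
          ring
  refine le_inv_mul_of_mul_le hc0.ne'
    ((le_lintegral_graphChart hη hn hc hW hAW hf.measurable).trans ((lintegral_mono hpt).trans ?_))
  rw [lintegral_add_left (hγ.const_mul _), lintegral_const_mul _ hγ, lintegral_const_mul _ hGΨ]
  have hb := lintegral_graphChart_le hη hn hc hD hAD hG.measurable
  push_cast
  calc _ ≤ 2 * (R : ℝ≥0∞) * (∫⁻ y in A, ‖φ (graphMap n η y)‖ₑ ^ 2 ∂(hmeas n)) +
        2 * (R : ℝ≥0∞) ^ 2 * (c * ∫⁻ x in D, gradSq φ x) := by gcongr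
    _ ≤ 2 * (R : ℝ≥0∞) * (∫⁻ y in A, ‖φ (graphMap n η y)‖ₑ ^ 2 ∂(hmeas n)) +
        2 * (R : ℝ≥0∞) ^ 2 * (c * ∫⁻ x in D, gradSq φ x) +
        (2 * (R : ℝ≥0∞) * (∫⁻ x in D, gradSq φ x) +
          2 * (R : ℝ≥0∞) ^ 2 * (c * ∫⁻ y in A, ‖φ (graphMap n η y)‖ₑ ^ 2 ∂(hmeas n))) :=
        le_self_add
    _ = _ := by ring

end

section

variable {d : ℕ}

/-! ### Boundary charts -/

/-- Near a boundary point, an open set with Lipschitz boundary, its closure and its boundary are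
described by the sign of the height over a Lipschitz graph. -/
theorem HasLipschitzBoundary.exists_chart {U : Set (E d)} (hU : IsOpen U)
    (hL : HasLipschitzBoundary U) {x₀ : E d} (hx₀ : x₀ ∈ frontier U) :
    ∃ (n : E d) (K : ℝ≥0) (η : E d → ℝ), ‖n‖ = 1 ∧ LipschitzWith K η ∧
      ∃ V : Set (E d), IsOpen V ∧ x₀ ∈ V ∧ ∀ x ∈ V,
        (x ∈ U ↔ 0 < graphHeight n η x) ∧ (x ∈ closure U ↔ 0 ≤ graphHeight n η x) ∧
        (x ∈ frontier U ↔ graphHeight n η x = 0) := by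
  obtain ⟨n, hn, K, η, hη, V', hV', h⟩ := hL x₀ hx₀
  obtain ⟨V, hVV', hV, hxV⟩ := mem_nhds_iff.1 hV'
  have hc := continuous_graphHeight (n := n) hη.continuous
  have hU' : ∀ x ∈ V, (x ∈ U ↔ 0 < graphHeight n η x) := fun x hx => by
    rw [h x (hVV' hx), graphHeight, sub_pos]
  have hcl : ∀ x ∈ V, (x ∈ closure U ↔ 0 ≤ graphHeight n η x) := by
    intro x hx
    constructor
    · intro hxU
      by_contra! hneg
      obtain ⟨z, ⟨hzV, hz⟩, hzU⟩ := mem_closure_iff.1 hxU (V ∩ {z | graphHeight n η z < 0})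
        (hV.inter (isOpen_lt hc continuous_const)) ⟨hx, hneg⟩
      exact lt_asymm hz ((hU' z hzV).1 hzU)
    · intro hpos
      have hlim : Filter.Tendsto (fun t : ℝ => x + t • n) (𝓝[>] 0) (𝓝 x) := by
        have : Continuous fun t : ℝ => x + t • n := by fun_prop
        simpa using (this.tendsto 0).mono_left nhdsWithin_le_nhds
      refine mem_closure_of_tendsto hlim ?_
      filter_upwards [hlim.eventually (hV.mem_nhds hx), self_mem_nhdsWithin] with t ht ht0
      rw [hU' _ ht, graphHeight_add_smul hn]
      exact add_pos_of_nonneg_of_pos hpos ht0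
  refine ⟨n, K, η, hn, hη, V, hV, hxV, fun x hx => ⟨hU' x hx, hcl x hx, ?_⟩⟩
  rw [frontier, hU.interior_eq, mem_sdiff, hcl x hx, hU' x hx, not_lt, and_comm]
  exact le_antisymm_iff.symm

/-- A neighbourhood of a point of a graph contains a cylinder in graph coordinates. -/
theorem exists_cylinder {n : E d} {η : E d → ℝ} (hn : ‖n‖ = 1) (hη : Continuous η) {σ : ℝ}
    (hσ : σ * σ = 1) {V : Set (E d)} (hV : IsOpen V) {x₀ : E d} (hx₀ : x₀ ∈ V)
    (h0 : graphHeight n η x₀ = 0) :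
    ∃ r > 0, ∀ y ∈ Metric.ball (hproj n x₀) r, ∀ s : ℝ, |s| < r →
      graphChart n η σ (y, s) ∈ V := by
  have hV' : graphChart n η σ ⁻¹' V ∈ 𝓝 (hproj n x₀, (0 : ℝ)) := by
    refine (hV.preimage (continuous_graphChart hη σ)).mem_nhds ?_
    have h := graphChart_hproj_graphHeight (η := η) hn hσ x₀
    rw [h0, mul_zero] at h
    rw [mem_preimage, h]
    exact hx₀
  obtain ⟨r, hr, hball⟩ := Metric.mem_nhds_iff.1 hV'
  refine ⟨r, hr, fun y hy s hs => hball ?_⟩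
  rw [← ball_prod_same]
  exact ⟨hy, by simpa using hs⟩

theorem graphMap_hproj {n : E d} {η : E d → ℝ} (hn : ‖n‖ = 1) {x : E d}
    (h0 : graphHeight n η x = 0) : graphMap n η (hproj n x) = x := by
  have h := graphChart_hproj_graphHeight (η := η) hn (one_mul 1) x
  rwa [h0, mul_zero, graphChart_zero] at h

theorem graphHeight_graphMap {n : E d} {η : E d → ℝ} (hn : ‖n‖ = 1) (y : Hyperplane n) :
    graphHeight n η (graphMap n η y) = 0 := by
  rw [← graphChart_zero 1, graphHeight_graphChart hn, mul_zero]

/-- The trace inequality near a point of the outer boundary. -/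
theorem exists_local_trace_le {Ω F : Set (E d)} (hΩ : IsOpen Ω) (hL : HasLipschitzBoundary Ω)
    (hF : IsClosed F) (hFΩ : F ⊆ Ω) {x₀ : E d} (hx₀ : x₀ ∈ frontier Ω) :
    ∃ W ∈ 𝓝 x₀, ∃ C : ℝ≥0, ∀ φ : E d → E d, ContDiff ℝ ∞ φ →
      ∫⁻ x in frontier Ω ∩ W, ‖φ x‖ₑ ^ 2 ∂(surf d) ≤
        C * ((∫⁻ x in Ω \ F, ‖φ x‖ₑ ^ 2) + ∫⁻ x in Ω \ F, gradSq φ x) := by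
  obtain ⟨n, K, η, hn, hη, V, hV, hxV, hch⟩ := hL.exists_chart hΩ hx₀
  have hx₀F : x₀ ∉ F := fun h => (hΩ.frontier_eq ▸ hx₀).2 (hFΩ h)
  have h0 := (hch x₀ hxV).2.2.1 hx₀
  have hσ : (1 : ℝ) * 1 = 1 := one_mul 1
  obtain ⟨r, hr, hcyl⟩ := exists_cylinder hn hη.continuous hσ (hV.inter hF.isOpen_compl)
    ⟨hxV, hx₀F⟩ h0
  set A : Set (Hyperplane n) := Metric.ball (hproj n x₀) r
  obtain ⟨C, hC⟩ := exists_lintegral_graph_le hn hη.continuous hσ (A := A) hr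
    (hΩ.sdiff hF).measurableSet fun y hy s hs => by
      obtain ⟨h1, h2⟩ := hcyl y hy s (by rw [abs_of_pos hs.1]; exact hs.2)
      refine ⟨(hch _ h1).1.2 ?_, h2⟩
      rw [graphHeight_graphChart hn, one_mul]
      exact hs.1
  refine ⟨V ∩ hproj n ⁻¹' A, Filter.inter_mem (hV.mem_nhds hxV)
    ((hproj n).continuous.continuousAt.preimage_mem_nhds (Metric.ball_mem_nhds _ hr)),
    (1 + K) ^ ((d : ℝ) - 1) * C, fun φ hφ => ?_⟩
  have hf : Continuous fun x => ‖φ x‖ₑ ^ 2 := (ENNReal.continuous_pow 2).comp hφ.continuous.enorm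
  calc ∫⁻ x in frontier Ω ∩ (V ∩ hproj n ⁻¹' A), ‖φ x‖ₑ ^ 2 ∂(surf d)
      ≤ ∫⁻ x in graphMap n η '' A, ‖φ x‖ₑ ^ 2 ∂(surf d) :=
        lintegral_mono_set fun x hx =>
          ⟨hproj n x, hx.2.2, graphMap_hproj hn ((hch x hx.2.1).2.2.1 hx.1)⟩
    _ ≤ _ := setLIntegral_graph_le hn hη hf.measurable
    _ ≤ _ := by
        rw [ENNReal.coe_mul, ENNReal.coe_rpow_of_nonneg _ (zero_le_dim_sub_one hn), mul_assoc]
        gcongr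
        exact hC φ hφ

/-- Near a point of the inner boundary, functions outside the hole are controlled by their
boundary values and their gradient. -/
theorem exists_local_le_of_frontier {Ω B : Set (E d)} (hΩ : IsOpen Ω) (hB : IsOpen B)
    (hL : HasLipschitzBoundary B) (hBΩ : closure B ⊆ Ω) {x₀ : E d} (hx₀ : x₀ ∈ frontier B) :
    ∃ W ∈ 𝓝 x₀, ∃ C : ℝ≥0, ∀ φ : E d → E d, ContDiff ℝ ∞ φ →
      ∫⁻ x in annular Ω B ∩ W, ‖φ x‖ₑ ^ 2 ≤
        C * ((∫⁻ x in annular Ω B, gradSq φ x) +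
          ∫⁻ x in frontier B, ‖φ x‖ₑ ^ 2 ∂(surf d)) := by
  obtain ⟨n, K, η, hn, hη, V, hV, hxV, hch⟩ := hL.exists_chart hB hx₀
  have h0 := (hch x₀ hxV).2.2.1 hx₀
  have hσ : (-1 : ℝ) * -1 = 1 := by norm_num
  obtain ⟨r, hr, hcyl⟩ := exists_cylinder hn hη.continuous hσ (hV.inter hΩ)
    ⟨hxV, hBΩ (frontier_subset_closure hx₀)⟩ h0
  set A : Set (Hyperplane n) := Metric.ball (hproj n x₀) r
  have hD : MeasurableSet (annular Ω B) := (hΩ.sdiff isClosed_closure).measurableSet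
  have hcont := continuous_graphHeight (n := n) hη.continuous
  set W : Set (E d) := V ∩ hproj n ⁻¹' A ∩ {x | -r < graphHeight n η x} with hWdef
  have hWo : IsOpen W := (hV.inter (Metric.isOpen_ball.preimage (hproj n).continuous)).inter
    (isOpen_lt continuous_const hcont)
  have hAD : ∀ y ∈ A, ∀ s ∈ Ioo 0 r, graphChart n η (-1) (y, s) ∈ annular Ω B := by
    intro y hy s hs
    obtain ⟨h1, h2⟩ := hcyl y hy s (by rw [abs_of_pos hs.1]; exact hs.2)
    refine ⟨h2, fun h3 => ?_⟩
    have h4 := (hch _ h1).2.1.1 h3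
    rw [graphHeight_graphChart hn] at h4
    linarith [hs.1]
  have hAW : ∀ y s, graphChart n η (-1) (y, s) ∈ annular Ω B ∩ W → y ∈ A ∧ s ∈ Ioo 0 r := by
    rintro y s ⟨⟨-, hcl⟩, ⟨hxV', hxA⟩, hxr⟩
    rw [mem_preimage, hproj_graphChart] at hxA
    rw [(hch _ hxV').2.1, graphHeight_graphChart hn, not_le] at hcl
    rw [mem_ofPred_eq, graphHeight_graphChart hn] at hxr
    exact ⟨hxA, by linarith, by linarith⟩
  obtain ⟨C, hC⟩ := exists_lintegral_collar_le hn hη.continuous hσ hD hAD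
    (hD.inter hWo.measurableSet) hAW
  have hxA : hproj n x₀ ∈ A := Metric.mem_ball_self hr
  have hxW : x₀ ∈ W := by
    refine ⟨⟨hxV, hxA⟩, ?_⟩
    rw [mem_ofPred_eq, h0]
    linarith
  refine ⟨W, hWo.mem_nhds hxW, C, fun φ hφ => ?_⟩
  have hf : Continuous fun x => ‖φ x‖ₑ ^ 2 := (ENNReal.continuous_pow 2).comp hφ.continuous.enorm
  refine (hC φ hφ).trans (mul_le_mul_right (add_le_add le_rfl ?_) _)
  refine (setLIntegral_hyperplane_le hn hη hf.measurable).trans (lintegral_mono_set ?_)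
  rintro _ ⟨y, hy, rfl⟩
  have h1 := (hcyl y hy 0 (by simpa using hr)).1
  rw [graphChart_zero] at h1
  exact (hch _ h1).2.2.2 (graphHeight_graphMap hn y)

/-! ### The trace inequality and the Poincaré inequality for smooth functions -/

/-- A family of local estimates near the points of a compact set gives a global estimate. -/
theorem exists_lintegral_le_of_compact {S T : Set (E d)} (hT : IsCompact T) (hST : S ⊆ T)
    (ν : Measure (E d)) (Q : (E d → E d) → ℝ≥0∞)
    (hloc : ∀ x ∈ T, ∃ W ∈ 𝓝 x, ∃ C : ℝ≥0, ∀ φ : E d → E d, ContDiff ℝ ∞ φ →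
      ∫⁻ x in S ∩ W, ‖φ x‖ₑ ^ 2 ∂ν ≤ C * Q φ) :
    ∃ C : ℝ≥0, ∀ φ : E d → E d, ContDiff ℝ ∞ φ → ∫⁻ x in S, ‖φ x‖ₑ ^ 2 ∂ν ≤ C * Q φ := by
  have key : ∃ C : ℝ≥0, ∀ φ : E d → E d, ContDiff ℝ ∞ φ →
      ∫⁻ x in S ∩ T, ‖φ x‖ₑ ^ 2 ∂ν ≤ C * Q φ := by
    refine hT.induction_on (p := fun W => ∃ C : ℝ≥0, ∀ φ : E d → E d, ContDiff ℝ ∞ φ →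
      ∫⁻ x in S ∩ W, ‖φ x‖ₑ ^ 2 ∂ν ≤ C * Q φ) ⟨0, fun φ _ => by simp⟩ ?_ ?_ ?_
    · rintro s t hst ⟨C, hC⟩
      exact ⟨C, fun φ hφ =>
        (lintegral_mono_set (inter_subset_inter_right S hst)).trans (hC φ hφ)⟩
    · rintro s t ⟨C, hC⟩ ⟨C', hC'⟩
      refine ⟨C + C', fun φ hφ => ?_⟩
      rw [inter_union_distrib_left, ENNReal.coe_add, add_mul]
      exact (lintegral_union_le _ _ _).trans (add_le_add (hC φ hφ) (hC' φ hφ))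
    · intro x hx
      obtain ⟨W, hW, h⟩ := hloc x hx
      exact ⟨W, mem_nhdsWithin_of_mem_nhds hW, h⟩
  rwa [inter_eq_left.2 hST] at key

theorem exists_trace_le {Ω F : Set (E d)} (hΩ : IsOpen Ω) (hΩb : Bornology.IsBounded Ω)
    (hL : HasLipschitzBoundary Ω) (hF : IsClosed F) (hFΩ : F ⊆ Ω) :
    ∃ C : ℝ≥0, ∀ φ : E d → E d, ContDiff ℝ ∞ φ →
      ∫⁻ x in frontier Ω, ‖φ x‖ₑ ^ 2 ∂(surf d) ≤
        C * ((∫⁻ x in Ω \ F, ‖φ x‖ₑ ^ 2) + ∫⁻ x in Ω \ F, gradSq φ x) :=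
  exists_lintegral_le_of_compact
    (hΩb.isCompact_closure.of_isClosed_subset isClosed_frontier frontier_subset_closure)
    subset_rfl (surf d) (fun φ => (∫⁻ x in Ω \ F, ‖φ x‖ₑ ^ 2) + ∫⁻ x in Ω \ F, gradSq φ x)
    fun _ hx => exists_local_trace_le hΩ hL hF hFΩ hx

/-- The point `x` has a neighbourhood on which the `L²` norm is controlled by the gradient on
`Ω \ closure B` and the values on `∂B`. -/
def IsControlled (Ω B : Set (E d)) (x : E d) : Prop :=
  ∃ W ∈ 𝓝 x, ∃ C : ℝ≥0, ∀ φ : E d → E d, ContDiff ℝ ∞ φ →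
    ∫⁻ x in annular Ω B ∩ W, ‖φ x‖ₑ ^ 2 ≤
      C * ((∫⁻ x in annular Ω B, gradSq φ x) + ∫⁻ x in frontier B, ‖φ x‖ₑ ^ 2 ∂(surf d))

theorem IsControlled.eventually {Ω B : Set (E d)} {x : E d} (h : IsControlled Ω B x) :
    ∀ᶠ y in 𝓝 x, IsControlled Ω B y := by
  obtain ⟨W, hW, h⟩ := h
  filter_upwards [eventually_mem_nhds_iff.2 hW] with y hy
  exact ⟨W, hy, h⟩

/-- Control propagates along translations: if the segments from points of `Ω \ closure B` near `x`
to their translates by `h` stay in `Ω \ closure B`, control at `x + h` gives control at `x`. -/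
theorem IsControlled.of_translate {Ω B : Set (E d)} (hΩ : IsOpen Ω) {x h : E d}
    (hxh : IsControlled Ω B (x + h)) {W : Set (E d)} (hW : W ∈ 𝓝 x)
    (hseg : ∀ z ∈ annular Ω B ∩ W, ∀ s ∈ Ioc (0 : ℝ) 1, z + s • h ∈ annular Ω B) :
    IsControlled Ω B x := by
  obtain ⟨W', hW', C, hC⟩ := hxh
  obtain ⟨W'', hW'', hW''o, hxW''⟩ := mem_nhds_iff.1 hW'
  have hD : MeasurableSet (annular Ω B) := (hΩ.sdiff isClosed_closure).measurableSet
  have htr : Continuous fun z : E d => z + h := by fun_prop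
  refine ⟨W ∩ (fun z => z + h) ⁻¹' W'', Filter.inter_mem hW
    ((hW''o.preimage htr).mem_nhds hxW''), 2 * C + 2 * ‖h‖₊ ^ 2, fun φ hφ => ?_⟩
  have h1 := lintegral_sq_le_translate hφ (A := annular Ω B ∩ (W ∩ (fun z => z + h) ⁻¹' W''))
    (A' := annular Ω B ∩ W'') (hD.inter hW''o.measurableSet) hD (h := h)
    (fun z hz => ⟨by simpa using hseg z ⟨hz.1, hz.2.1⟩ 1 (by simp), hz.2.2⟩)
    (fun z hz => hseg z ⟨hz.1, hz.2.1⟩)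
  have h2 := (lintegral_mono_set (inter_subset_inter_right _ hW'')).trans (hC φ hφ)
  refine h1.trans ?_
  push_cast
  rw [add_mul, enorm_eq_nnnorm, mul_assoc 2 (C : ℝ≥0∞)]
  gcongr
  exact le_self_add

/-- Every point of `closure Ω` is controlled. The controlled points of `Ω \ closure B` together
with `closure B` form a subset of `Ω` that is open (by the estimate near `∂B`) and relatively
closed (by translation), hence all of `Ω`; points of `∂Ω` are reached by translating into `Ω`. -/
theorem isControlled_of_mem_closure {Ω B : Set (E d)} (hΩ : IsOpen Ω) (hΩc : IsConnected Ω)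
    (hΩL : HasLipschitzBoundary Ω) (hB : IsOpen B) (hBne : B.Nonempty)
    (hBL : HasLipschitzBoundary B) (hBΩ : closure B ⊆ Ω) :
    ∀ x ∈ closure Ω, IsControlled Ω B x := by
  have hDo : IsOpen (annular Ω B) := hΩ.sdiff isClosed_closure
  have hcB : ∀ x ∈ closure B, IsControlled Ω B x := by
    intro x hx
    by_cases hxB : x ∈ B
    · refine ⟨B, hB.mem_nhds hxB, 0, fun φ _ => ?_⟩
      have : annular Ω B ∩ B = ∅ :=
        eq_empty_of_forall_notMem fun z hz => hz.1.2 (subset_closure hz.2)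
      simp [this]
    · exact exists_local_le_of_frontier hΩ hB hBL hBΩ ⟨hx, by rwa [hB.interior_eq]⟩
  -- Openness is clear from the definition; closedness in `Ω` is the translation argument.
  have hsub : Ω ⊆ {x | IsControlled Ω B x} := by
    refine hΩc.isPreconnected.subset_of_closure_inter_subset
      (isOpen_iff_mem_nhds.2 fun x hx => IsControlled.eventually hx) ?_ ?_
    · obtain ⟨b, hb⟩ := hBne
      exact ⟨b, hBΩ (subset_closure hb), hcB b (subset_closure hb)⟩
    · rintro x ⟨hxcl, hxΩ⟩
      by_cases hxB : x ∈ closure B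
      · exact hcB x hxB
      obtain ⟨ε, hε, hball⟩ := Metric.isOpen_iff.1 hDo x ⟨hxΩ, hxB⟩
      obtain ⟨y, hy, hxy⟩ := Metric.mem_closure_iff.1 hxcl (ε / 2) (half_pos hε)
      refine IsControlled.of_translate hΩ (h := y - x) (by rwa [add_sub_cancel])
        (Metric.ball_mem_nhds x (half_pos hε)) fun z hz s hs => hball ?_
      rw [Metric.mem_ball, dist_eq_norm]
      have h1 : ‖z - x‖ < ε / 2 := by rw [← dist_eq_norm]; exact hz.2
      have h2 : ‖s • (y - x)‖ ≤ ‖y - x‖ := by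
        rw [norm_smul, Real.norm_of_nonneg hs.1.le]
        exact mul_le_of_le_one_left (norm_nonneg _) hs.2
      rw [dist_comm, dist_eq_norm] at hxy
      calc ‖z + s • (y - x) - x‖ = ‖(z - x) + s • (y - x)‖ := by congr 1; abel
        _ ≤ ‖z - x‖ + ‖s • (y - x)‖ := norm_add_le _ _
        _ < ε := by linarith
  intro x hx
  by_cases hxΩ : x ∈ Ω
  · exact hsub hxΩ
  have hxfr : x ∈ frontier Ω := ⟨hx, by rwa [hΩ.interior_eq]⟩
  obtain ⟨n, K, η, hn, hη, V, hV, hxV, hch⟩ := hΩL.exists_chart hΩ hxfr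
  have hxB : x ∉ closure B := fun h => hxΩ (hBΩ h)
  obtain ⟨ε, hε, hball⟩ := Metric.isOpen_iff.1 (hV.inter isClosed_closure.isOpen_compl) x
    ⟨hxV, hxB⟩
  have hmem : ∀ t ∈ Ioc 0 (ε / 2), ∀ z ∈ Metric.ball x (ε / 2), 0 ≤ graphHeight n η z →
      z + t • n ∈ annular Ω B := by
    intro t ht z hz hz0
    have h1 : z + t • n ∈ V ∩ (closure B)ᶜ := by
      refine hball ?_
      rw [Metric.mem_ball, dist_eq_norm]
      have h1 : ‖z - x‖ < ε / 2 := by rw [← dist_eq_norm]; exact hz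
      have h2 : ‖t • n‖ ≤ ε / 2 := by
        rw [norm_smul, hn, mul_one, Real.norm_of_nonneg ht.1.le]
        exact ht.2
      calc ‖z + t • n - x‖ = ‖(z - x) + t • n‖ := by congr 1; abel
        _ ≤ ‖z - x‖ + ‖t • n‖ := norm_add_le _ _
        _ < ε := by linarith
    refine ⟨(hch _ h1.1).1.2 ?_, h1.2⟩
    rw [graphHeight_add_smul hn]
    linarith [ht.1]
  refine IsControlled.of_translate hΩ (h := (ε / 2) • n) (hsub ?_)
    (Metric.ball_mem_nhds x (half_pos hε)) fun z hz s hs => ?_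
  · exact (hmem (ε / 2) ⟨half_pos hε, le_rfl⟩ x (Metric.mem_ball_self (half_pos hε))
      ((hch x hxV).2.2.1 hxfr).ge).1
  · rw [smul_smul]
    refine hmem _ ⟨mul_pos hs.1 (half_pos hε), mul_le_of_le_one_left (half_pos hε).le hs.2⟩ z
      hz.2 ?_
    have hzV : z ∈ V := (hball (Metric.ball_subset_ball (by linarith) hz.2)).1
    exact ((hch z hzV).1.1 hz.1.1).le

theorem exists_poincare_le {Ω B : Set (E d)} (hΩ : IsOpen Ω) (hΩc : IsConnected Ω)
    (hΩb : Bornology.IsBounded Ω) (hΩL : HasLipschitzBoundary Ω) (hB : IsOpen B)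
    (hBne : B.Nonempty) (hBL : HasLipschitzBoundary B) (hBΩ : closure B ⊆ Ω) :
    ∃ C : ℝ≥0, ∀ φ : E d → E d, ContDiff ℝ ∞ φ →
      ∫⁻ x in annular Ω B, ‖φ x‖ₑ ^ 2 ≤
        C * ((∫⁻ x in annular Ω B, gradSq φ x) +
          ∫⁻ x in frontier B, ‖φ x‖ₑ ^ 2 ∂(surf d)) :=
  exists_lintegral_le_of_compact hΩb.isCompact_closure
    (sdiff_subset.trans subset_closure) volume
    (fun φ => (∫⁻ x in annular Ω B, gradSq φ x) + ∫⁻ x in frontier B, ‖φ x‖ₑ ^ 2 ∂(surf d))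
    (isControlled_of_mem_closure hΩ hΩc hΩL hB hBne hBL hBΩ)

end

section

variable {d : ℕ}

/-! ### The Hilbert space `H¹` -/

/-- `u ↦ u` as a continuous linear map from `H¹` to `L²`. -/
noncomputable def H1.toL2L (U : Set (E d)) : H1 U →L[ℝ] L2 U :=
  (WithLp.fstL 2 ℝ (L2 U) (PiLp 2 (fun _ : Fin d => L2 U))).comp (H1 U).subtypeL

/-- `u ↦ ∂ᵢu` as a continuous linear map from `H¹` to `L²`. -/
noncomputable def H1.gradL (U : Set (E d)) (i : Fin d) : H1 U →L[ℝ] L2 U :=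
  (PiLp.proj 2 (fun _ : Fin d => L2 U) i).comp
    ((WithLp.sndL 2 ℝ (L2 U) (PiLp 2 (fun _ : Fin d => L2 U))).comp (H1 U).subtypeL)

theorem H1.toL2L_apply {U : Set (E d)} (u : H1 U) : H1.toL2L U u = H1.toL2 u := rfl

theorem H1.gradL_apply {U : Set (E d)} (i : Fin d) (u : H1 U) :
    H1.gradL U i u = H1.grad u i := rfl

theorem H1.norm_sq {U : Set (E d)} (u : H1 U) :
    ‖u‖ ^ 2 = ‖H1.toL2 u‖ ^ 2 + ∑ i, ‖H1.grad u i‖ ^ 2 := by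
  rw [Submodule.coe_norm, WithLp.prod_norm_sq_eq_of_L2, PiLp.norm_sq_eq_of_L2]
  rfl

theorem dirichletForm_eq {U : Set (E d)} (v w : H1 U) :
    dirichletForm v w = ∑ i, inner ℝ (H1.grad v i) (H1.grad w i) := by
  rw [dirichletForm, integral_finsetSum _ fun i _ => L2.integrable_inner _ _]
  rfl

theorem memLp_of_continuous {φ : E d → E d} (hφ : Continuous φ) (hc : HasCompactSupport φ)
    (U : Set (E d)) : MemLp φ 2 ((volume : Measure (E d)).restrict U) :=
  (hφ.memLp_of_hasCompactSupport hc).restrict U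

theorem inner_integral_smul {U : Set (E d)} {ψ : E d → ℝ} (hψ : Continuous ψ)
    (hc : HasCompactSupport ψ) (e : E d) (u : L2 U) :
    inner ℝ e (∫ x in U, ψ x • u x) =
      inner ℝ ((memLp_of_continuous (φ := fun x => ψ x • e) (hψ.smul continuous_const)
        hc.smul_right U).toLp _) u := by
  rw [← integral_inner (integrable_smul_L2 hψ hc u), L2.inner_def]
  refine integral_congr_ae ?_
  filter_upwards [(memLp_of_continuous (φ := fun x => ψ x • e) (hψ.smul continuous_const)
    hc.smul_right U).coeFn_toLp] with x hx
  rw [hx, inner_smul_left, inner_smul_right]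
  rfl

theorem continuous_integral_smul {U : Set (E d)} {ψ : E d → ℝ} (hψ : Continuous ψ)
    (hc : HasCompactSupport ψ) : Continuous fun u : L2 U => ∫ x in U, ψ x • u x := by
  have h : Continuous fun u : L2 U =>
      ∑ i, inner ℝ (EuclideanSpace.single i (1 : ℝ)) (∫ x in U, ψ x • u x) •
        EuclideanSpace.single i (1 : ℝ) := by
    refine continuous_finsetSum _ fun i _ => ?_
    simp only [inner_integral_smul hψ hc]
    fun_prop
  refine h.congr fun u => ?_
  simpa [OrthonormalBasis.repr_apply_apply] using
    (EuclideanSpace.basisFun (Fin d) ℝ).sum_repr' (∫ x in U, ψ x • u x)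

theorem isClosed_H1 (U : Set (E d)) :
    IsClosed (H1 U : Set (WithLp 2 (L2 U × PiLp 2 (fun _ : Fin d => L2 U)))) := by
  have : (H1 U : Set (WithLp 2 (L2 U × PiLp 2 (fun _ : Fin d => L2 U)))) =
      ⋂ (i : Fin d), {u | IsWeakPartial i u.fst (u.snd i)} := by
    ext u
    rw [mem_iInter]
    exact Iff.rfl
  rw [this]
  refine isClosed_iInter fun i => ?_
  simp only [IsWeakPartial, ofPred_forall]
  refine isClosed_iInter fun φ => isClosed_iInter fun h1 => isClosed_iInter fun h2 =>
    isClosed_iInter fun _ => isClosed_eq ?_ ?_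
  · exact (continuous_integral_smul (continuous_partialDeriv h1 i)
      (hasCompactSupport_partialDeriv h2 i)).comp
      (WithLp.fstL 2 ℝ (L2 U) (PiLp 2 (fun _ : Fin d => L2 U))).continuous
  · exact ((continuous_integral_smul h1.continuous h2).comp
      ((PiLp.proj (𝕜 := ℝ) 2 (fun _ : Fin d => L2 U) i).comp
        (WithLp.sndL 2 ℝ (L2 U) (PiLp 2 (fun _ : Fin d => L2 U)))).continuous).neg

instance (U : Set (E d)) : CompleteSpace (H1 U) := (isClosed_H1 U).completeSpace_coe

/-! ### Smooth functions in `H¹` -/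

/-- The smooth function `φ` represents `u ∈ H¹(U; ℝ^d)`. -/
def Represents {U : Set (E d)} (φ : E d → E d) (u : H1 U) : Prop :=
  H1.toL2 u =ᵐ[(volume : Measure (E d)).restrict U] φ ∧
  ∀ i, H1.grad u i =ᵐ[(volume : Measure (E d)).restrict U] partialDeriv i φ

theorem continuous_partialDeriv' {φ : E d → E d} (hφ : ContDiff ℝ ∞ φ) (i : Fin d) :
    Continuous (partialDeriv i φ) :=
  (hφ.continuous_fderiv (by simp)).clm_apply continuous_const

/-- A smooth compactly supported function belongs to `H¹`: its classical derivatives are weak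
derivatives. -/
theorem exists_represents (U : Set (E d)) {φ : E d → E d} (hφ : ContDiff ℝ ∞ φ)
    (hc : HasCompactSupport φ) : ∃ u : H1 U, Represents φ u := by
  have hm := memLp_of_continuous hφ.continuous hc U
  have hmi : ∀ i, MemLp (partialDeriv i φ) 2 ((volume : Measure (E d)).restrict U) := fun i =>
    memLp_of_continuous (continuous_partialDeriv' hφ i)
      (hc.fderiv_apply ℝ (EuclideanSpace.single i 1)) U
  have hmem : WithLp.toLp 2 (hm.toLp φ, WithLp.toLp 2 fun i => (hmi i).toLp (partialDeriv i φ)) ∈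
      H1 U := by
    intro i ψ h1 h2 h3
    have e1 : ∫ x in U, partialDeriv i ψ x • (hm.toLp φ) x = ∫ x, partialDeriv i ψ x • φ x := by
      rw [← setIntegral_eq_integral_of_forall_compl_eq_zero (μ := volume) (s := U)
        (f := fun x => partialDeriv i ψ x • φ x) fun x hx => ?_]
      · refine integral_congr_ae ?_
        filter_upwards [hm.coeFn_toLp] with x hx
        rw [hx]
      · have h0 : x ∉ tsupport (fderiv ℝ ψ) := fun h => hx (h3 (tsupport_fderiv_subset ℝ h))
        simp [partialDeriv, image_eq_zero_of_notMem_tsupport h0]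
    have e2 : ∫ x in U, ψ x • ((hmi i).toLp (partialDeriv i φ)) x =
        ∫ x, ψ x • partialDeriv i φ x := by
      rw [← setIntegral_eq_integral_of_forall_compl_eq_zero (μ := volume) (s := U)
        (f := fun x => ψ x • partialDeriv i φ x) fun x hx => ?_]
      · refine integral_congr_ae ?_
        filter_upwards [(hmi i).coeFn_toLp] with x hx
        rw [hx]
      · rw [image_eq_zero_of_notMem_tsupport fun h => hx (h3 h), zero_smul]
    refine e1.trans (Eq.trans ?_ (congrArg Neg.neg e2.symm))
    have := integral_smul_fderiv_eq_neg_fderiv_smul_of_integrable (μ := (volume : Measure (E d)))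
      (f := ψ) (g := φ) (v := EuclideanSpace.single i 1) (𝕜 := ℝ)
      (((continuous_partialDeriv h1 i).smul hφ.continuous).integrable_of_hasCompactSupport
        hc.smul_left)
      ((h1.continuous.smul (continuous_partialDeriv' hφ i)).integrable_of_hasCompactSupport
        h2.smul_right)
      ((h1.continuous.smul hφ.continuous).integrable_of_hasCompactSupport h2.smul_right)
      (fun x _ => h1.differentiable (by simp) x) (fun x _ => hφ.differentiable (by simp) x)
    exact (neg_eq_iff_eq_neg.2 this).symm
  exact ⟨⟨_, hmem⟩, hm.coeFn_toLp, fun i => (hmi i).coeFn_toLp⟩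

theorem Represents.sub {U : Set (E d)} {φ ψ : E d → E d} {u v : H1 U} (hφ : ContDiff ℝ ∞ φ)
    (hψ : ContDiff ℝ ∞ ψ) (hu : Represents φ u) (hv : Represents ψ v) :
    Represents (φ - ψ) (u - v) := by
  refine ⟨(Lp.coeFn_sub (H1.toL2 u) (H1.toL2 v)).trans (hu.1.sub hv.1), fun i => ?_⟩
  refine ((Lp.coeFn_sub (H1.grad u i) (H1.grad v i)).trans ((hu.2 i).sub (hv.2 i))).trans ?_
  refine Filter.Eventually.of_forall fun x => ?_
  simp only [partialDeriv, Pi.sub_apply]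
  rw [fderiv_sub (hφ.differentiable (by simp) x) (hψ.differentiable (by simp) x)]
  rfl

theorem Lp_enorm_sq_eq {μ : Measure (E d)} {f : Lp (E d) 2 μ} {φ : E d → E d} (h : f =ᵐ[μ] φ) :
    ‖f‖ₑ ^ 2 = ∫⁻ x, ‖φ x‖ₑ ^ 2 ∂μ := by
  rw [Lp.enorm_def, eLpNorm_congr_ae h,
    eLpNorm_eq_lintegral_rpow_enorm_toReal (by norm_num) (by norm_num), ← ENNReal.rpow_natCast,
    ← ENNReal.rpow_mul]
  norm_num

theorem Represents.enorm_toL2 {U : Set (E d)} {φ : E d → E d} {u : H1 U} (h : Represents φ u) :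
    ‖H1.toL2 u‖ₑ ^ 2 = ∫⁻ x in U, ‖φ x‖ₑ ^ 2 := Lp_enorm_sq_eq h.1

theorem Represents.enorm_grad {U : Set (E d)} {φ : E d → E d} (hφ : ContDiff ℝ ∞ φ) {u : H1 U}
    (h : Represents φ u) : ∑ i, ‖H1.grad u i‖ₑ ^ 2 = ∫⁻ x in U, gradSq φ x := by
  unfold gradSq
  rw [lintegral_finsetSum _ fun i _ =>
    ((continuous_partialDeriv' hφ i).enorm.measurable.pow_const 2)]
  exact Finset.sum_congr rfl fun i _ => Lp_enorm_sq_eq (h.2 i)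

theorem H1.enorm_sq {U : Set (E d)} (u : H1 U) :
    ‖u‖ₑ ^ 2 = ‖H1.toL2 u‖ₑ ^ 2 + ∑ i, ‖H1.grad u i‖ₑ ^ 2 := by
  have h : ‖u‖₊ ^ 2 = ‖H1.toL2 u‖₊ ^ 2 + ∑ i, ‖H1.grad u i‖₊ ^ 2 := by
    rw [← NNReal.coe_inj]
    push_cast
    exact H1.norm_sq u
  simp only [enorm_eq_nnnorm]
  exact_mod_cast h

/-! ### Estimates on the trace graph -/

theorem traceGraph_induction {U S : Set (E d)} {P : H1 U × L2Surf S → Prop}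
    (hP : IsClosed {p | P p})
    (hs : ∀ (φ : E d → E d) (u : H1 U) (g : L2Surf S), ContDiff ℝ ∞ φ → Represents φ u →
      g =ᵐ[(surf d).restrict S] φ → P (u, g)) {u : H1 U} {g : L2Surf S} (h : HasTrace u g) :
    P (u, g) := by
  have hsub : (smoothTraceGraph U S : Set (H1 U × L2Surf S)) ⊆ {p | P p} := by
    rintro ⟨u, g⟩ ⟨φ, h1, -, h3, h4, h5⟩
    exact hs φ u g h1 ⟨h3, h4⟩ h5
  exact closure_minimal hsub hP h

/-- The trace inequality, extended from smooth functions to the whole trace graph. In particular a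
function has at most one trace on `∂Ω`. -/
theorem exists_norm_trace_le {Ω F : Set (E d)} (hΩ : IsOpen Ω) (hΩb : Bornology.IsBounded Ω)
    (hL : HasLipschitzBoundary Ω) (hF : IsClosed F) (hFΩ : F ⊆ Ω) :
    ∃ C : ℝ, 0 ≤ C ∧ ∀ (u : H1 (Ω \ F)) (g : L2Surf (frontier Ω)), HasTrace u g →
      ‖g‖ ^ 2 ≤ C * ‖u‖ ^ 2 := by
  obtain ⟨C, hC⟩ := exists_trace_le hΩ hΩb hL hF hFΩ
  refine ⟨C, C.2, fun u g h => traceGraph_induction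
    (P := fun p => ‖p.2‖ ^ 2 ≤ C * ‖p.1‖ ^ 2) (isClosed_le (by fun_prop) (by fun_prop)) ?_ h⟩
  intro φ u g hφ hu hg
  have h1 : ‖g‖ₑ ^ 2 ≤ C * ‖u‖ₑ ^ 2 := by
    rw [H1.enorm_sq, hu.enorm_toL2, hu.enorm_grad hφ, Lp_enorm_sq_eq hg]
    exact hC φ hφ
  simp only [enorm_eq_nnnorm] at h1
  have h2 : ‖g‖₊ ^ 2 ≤ C * ‖u‖₊ ^ 2 := by exact_mod_cast h1
  exact_mod_cast h2

/-- The Poincaré inequality for functions vanishing on the inner boundary: there the Dirichlet form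
is coercive. -/
theorem exists_norm_sq_le_dirichletForm {Ω B : Set (E d)} (hΩ : IsOpen Ω) (hΩc : IsConnected Ω)
    (hΩb : Bornology.IsBounded Ω) (hΩL : HasLipschitzBoundary Ω) (hB : IsOpen B)
    (hBne : B.Nonempty) (hBL : HasLipschitzBoundary B) (hBΩ : closure B ⊆ Ω) :
    ∃ C : ℝ, 0 < C ∧ ∀ u : H1 (annular Ω B), HasTrace u (0 : L2Surf (frontier B)) →
      ‖u‖ ^ 2 ≤ C * dirichletForm u u := by
  obtain ⟨C, hC⟩ := exists_poincare_le hΩ hΩc hΩb hΩL hB hBne hBL hBΩ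
  refine ⟨C + 1, by positivity, fun u h => ?_⟩
  have key := traceGraph_induction
    (P := fun p => ‖H1.toL2 p.1‖ ^ 2 ≤ C * ((∑ i, ‖H1.grad p.1 i‖ ^ 2) + ‖p.2‖ ^ 2))
    (isClosed_le ?_ ?_) ?_ h
  · have h0 : dirichletForm u u = ∑ i, ‖H1.grad u i‖ ^ 2 := by
      rw [dirichletForm_eq]
      exact Finset.sum_congr rfl fun i _ => real_inner_self_eq_norm_sq _
    rw [H1.norm_sq, h0]
    simp only [norm_zero] at key
    linarith
  · simp only [← H1.toL2L_apply]
    fun_prop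
  · simp only [← H1.gradL_apply]
    fun_prop
  · intro φ u g hφ hu hg
    have h1 : ‖H1.toL2 u‖ₑ ^ 2 ≤ C * ((∑ i, ‖H1.grad u i‖ₑ ^ 2) + ‖g‖ₑ ^ 2) := by
      rw [hu.enorm_toL2, hu.enorm_grad hφ, Lp_enorm_sq_eq hg]
      exact hC φ hφ
    simp only [enorm_eq_nnnorm] at h1
    have h2 : ‖H1.toL2 u‖₊ ^ 2 ≤ C * ((∑ i, ‖H1.grad u i‖₊ ^ 2) + ‖g‖₊ ^ 2) := by
      exact_mod_cast h1
    have h3 := NNReal.coe_le_coe.2 h2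
    push_cast at h3
    exact h3

end

section

variable {d : ℕ}

/-! ### Cut-off functions and the transfer of traces -/

/-- A smooth cut-off function equal to `1` on a compact set and to `0` near a disjoint closed
set. -/
theorem exists_cutoff {F S : Set (E d)} (hF : IsClosed F) (hS : IsCompact S) (hd : Disjoint F S) :
    ∃ χ : E d → ℝ, ContDiff ℝ ∞ χ ∧ HasCompactSupport χ ∧ (∀ x ∈ S, χ x = 1) ∧
      ∀ x ∈ F, x ∉ tsupport χ := by
  obtain ⟨R, hR⟩ := hS.isBounded.subset_ball (0 : E d)
  obtain ⟨f, hf0, hf1, -⟩ := exists_contMDiffMap_zero_one_nhds_of_isClosed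
    (modelWithCornersSelf ℝ (E d)) (n := ⊤)
    (hF.union (Metric.isOpen_ball (x := (0 : E d)) (ε := R)).isClosed_compl) hS.isClosed
    (disjoint_union_left.2 ⟨hd, disjoint_compl_left_iff_subset.2 hR⟩)
  have hz : ∀ x ∈ F ∪ (Metric.ball (0 : E d) R)ᶜ, x ∉ tsupport f := fun x hx =>
    notMem_tsupport_iff_eventuallyEq.2 (Filter.eventually_iff_exists_mem.2
      ⟨_, mem_nhdsSet_iff_forall.1 hf0 x hx, fun _ h => h⟩)
  refine ⟨f, f.contMDiff.contDiff, ?_, fun x hx => hf1.self_of_nhdsSet x hx,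
    fun x hx => hz x (Or.inl hx)⟩
  refine (isCompact_closedBall (0 : E d) R).of_isClosed_subset (isClosed_tsupport _) fun x hx => ?_
  by_contra hxR
  exact hz x (Or.inr fun h => hxR (Metric.ball_subset_closedBall h)) hx

theorem partialDeriv_smul {χ : E d → ℝ} {φ : E d → E d} (hχ : ContDiff ℝ ∞ χ)
    (hφ : ContDiff ℝ ∞ φ) (i : Fin d) (x : E d) :
    partialDeriv i (fun x => χ x • φ x) x =
      χ x • partialDeriv i φ x + partialDeriv i χ x • φ x := by
  rw [partialDeriv, fderiv_fun_smul (hχ.differentiable (by simp) x) (hφ.differentiable (by simp) x)]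
  rfl

theorem enorm_smul_sq_le {a : ℝ} {M : ℝ≥0} (h : ‖a‖ ≤ M) (v : E d) :
    ‖a • v‖ₑ ^ 2 ≤ (M : ℝ≥0∞) ^ 2 * ‖v‖ₑ ^ 2 := by
  rw [enorm_smul, mul_pow]
  gcongr
  rw [enorm_eq_nnnorm]
  exact_mod_cast h

/-- Multiplication by a cut-off function is bounded from `H¹(U₁)` to `H¹(U₂)`, when the support of
the cut-off function within `U₂` lies in `U₁`. -/
theorem exists_norm_cutoff_le {χ : E d → ℝ} (hχ : ContDiff ℝ ∞ χ) (hc : HasCompactSupport χ)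
    {U₁ U₂ : Set (E d)} (hU : ∀ x ∈ tsupport χ, x ∈ U₂ → x ∈ U₁) :
    ∃ C : ℝ≥0, ∀ (φ : E d → E d) (u : H1 U₁) (w : H1 U₂), ContDiff ℝ ∞ φ → Represents φ u →
      Represents (fun x => χ x • φ x) w → ‖w‖ ≤ C * ‖u‖ := by
  obtain ⟨M₀, hM₀⟩ := hc.exists_bound_of_continuous hχ.continuous
  have hpd : ∀ i, ∃ M : ℝ, ∀ x, ‖partialDeriv i χ x‖ ≤ M := fun i =>
    (hasCompactSupport_partialDeriv hc i).exists_bound_of_continuous (continuous_partialDeriv hχ i)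
  choose M' hM' using hpd
  set M : ℝ≥0 := M₀.toNNReal + ∑ i, (M' i).toNNReal with hM
  have hb : ∀ x, ‖χ x‖ ≤ M := fun x => by
    refine (hM₀ x).trans ((Real.le_coe_toNNReal _).trans ?_)
    exact_mod_cast le_self_add
  have hb' : ∀ i x, ‖partialDeriv i χ x‖ ≤ M := fun i x => by
    refine (hM' i x).trans ((Real.le_coe_toNNReal _).trans ?_)
    have h1 : (M' i).toNNReal ≤ ∑ i, (M' i).toNNReal :=
      Finset.single_le_sum (f := fun i => (M' i).toNNReal) (fun _ _ => zero_le) (Finset.mem_univ i)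
    exact_mod_cast h1.trans le_add_self
  set C : ℝ≥0 := (M ^ 2 + 2 * M ^ 2 + d * (2 * M ^ 2)) with hC
  refine ⟨NNReal.sqrt C, fun φ u w hφ hu hw => ?_⟩
  have hψ : ContDiff ℝ ∞ fun x => χ x • φ x := hχ.smul hφ
  have hcut : ∀ F G : E d → ℝ≥0∞, (∀ x ∉ tsupport χ, F x = 0) → (∀ x, F x ≤ G x) →
      ∫⁻ x in U₂, F x ≤ ∫⁻ x in U₁, G x := by
    intro F G hF hFG
    have h1 : F = (tsupport χ).indicator F := by
      refine (indicator_eq_self.2 fun x hx => ?_).symm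
      by_contra hx'
      exact hx (hF x hx')
    rw [h1, setLIntegral_indicator (isClosed_tsupport χ).measurableSet]
    exact (lintegral_mono_set fun x hx => hU x hx.1 hx.2).trans (lintegral_mono hFG)
  have h1 : ∫⁻ x in U₂, ‖χ x • φ x‖ₑ ^ 2 ≤ (M : ℝ≥0∞) ^ 2 * ∫⁻ x in U₁, ‖φ x‖ₑ ^ 2 := by
    rw [← lintegral_const_mul _ (hφ.continuous.enorm.measurable.pow_const 2)]
    refine hcut _ _ (fun x hx => ?_) fun x => enorm_smul_sq_le (hb x) _
    rw [image_eq_zero_of_notMem_tsupport hx]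
    simp
  have h2 : ∫⁻ x in U₂, gradSq (fun x => χ x • φ x) x ≤
      2 * (M : ℝ≥0∞) ^ 2 * (∫⁻ x in U₁, gradSq φ x) +
        d * (2 * (M : ℝ≥0∞) ^ 2) * ∫⁻ x in U₁, ‖φ x‖ₑ ^ 2 := by
    have hφm : Measurable fun x => ‖φ x‖ₑ ^ 2 := hφ.continuous.enorm.measurable.pow_const 2
    rw [← lintegral_const_mul _ hφm, ← lintegral_const_mul _ (continuous_gradSq hφ).measurable,
      ← lintegral_add_right _ (hφm.const_mul _)]
    refine hcut _ _ (fun x hx => ?_) fun x => ?_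
    · refine Finset.sum_eq_zero fun i _ => ?_
      have h0 : x ∉ tsupport (fderiv ℝ χ) := fun h => hx (tsupport_fderiv_subset ℝ h)
      rw [partialDeriv_smul hχ hφ, image_eq_zero_of_notMem_tsupport hx, partialDeriv,
        partialDeriv, image_eq_zero_of_notMem_tsupport h0]
      simp
    · have hi : ∀ i, ‖partialDeriv i (fun x => χ x • φ x) x‖ₑ ^ 2 ≤
          2 * (M : ℝ≥0∞) ^ 2 * ‖partialDeriv i φ x‖ₑ ^ 2 + 2 * (M : ℝ≥0∞) ^ 2 * ‖φ x‖ₑ ^ 2 := by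
        intro i
        rw [partialDeriv_smul hχ hφ, mul_assoc, mul_assoc]
        refine (enorm_add_sq_le _ _).trans ?_
        gcongr
        · exact enorm_smul_sq_le (hb x) _
        · exact enorm_smul_sq_le (hb' i x) _
      refine (Finset.sum_le_sum fun i _ => hi i).trans (le_of_eq ?_)
      rw [Finset.sum_add_distrib, ← Finset.mul_sum, Finset.sum_const, Finset.card_univ,
        Fintype.card_fin, nsmul_eq_mul]
      simp only [gradSq]
      ring
  have h3 : ‖w‖ₑ ^ 2 ≤ C * ‖u‖ₑ ^ 2 := by
    rw [H1.enorm_sq, H1.enorm_sq, hw.enorm_toL2, hw.enorm_grad hψ, hu.enorm_toL2,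
      hu.enorm_grad hφ]
    refine (add_le_add h1 h2).trans ?_
    rw [hC]
    push_cast
    set X := ∫⁻ x in U₁, ‖φ x‖ₑ ^ 2
    set Y := ∫⁻ x in U₁, gradSq φ x
    calc _ ≤ (M : ℝ≥0∞) ^ 2 * X + (2 * (M : ℝ≥0∞) ^ 2 * Y + d * (2 * (M : ℝ≥0∞) ^ 2) * X) +
          (2 * (M : ℝ≥0∞) ^ 2 * X + (M : ℝ≥0∞) ^ 2 * Y + d * (2 * (M : ℝ≥0∞) ^ 2) * Y) :=
          le_self_add
      _ = _ := by ring
  simp only [enorm_eq_nnnorm] at h3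
  have h4 : ‖w‖₊ ^ 2 ≤ C * ‖u‖₊ ^ 2 := by exact_mod_cast h3
  have h5 : ‖w‖₊ ≤ NNReal.sqrt C * ‖u‖₊ := by
    rw [← sq_le_sq₀ (zero_le) (zero_le), mul_pow, NNReal.sq_sqrt]
    exact h4
  have h6 := NNReal.coe_le_coe.2 h5
  rwa [NNReal.coe_mul, coe_nnnorm, coe_nnnorm] at h6

theorem Represents.hasTrace {U S : Set (E d)} {φ : E d → E d} {u : H1 U} {g : L2Surf S}
    (hφ : ContDiff ℝ ∞ φ) (hc : HasCompactSupport φ) (h : Represents φ u)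
    (hg : g =ᵐ[(surf d).restrict S] φ) : HasTrace u g :=
  subset_closure ⟨φ, hφ, hc, h.1, h.2, hg⟩

theorem isClosed_hasTrace {U S : Set (E d)} :
    IsClosed {p : H1 U × L2Surf S | HasTrace p.1 p.2} :=
  isClosed_closure (s := (smoothTraceGraph U S : Set (H1 U × L2Surf S)))

theorem HasTrace.exists_seq {U S : Set (E d)} {u : H1 U} {g : L2Surf S} (h : HasTrace u g) :
    ∃ (φ : ℕ → E d → E d) (v : ℕ → H1 U) (f : ℕ → L2Surf S),
      (∀ k, ContDiff ℝ ∞ (φ k)) ∧ (∀ k, HasCompactSupport (φ k)) ∧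
      (∀ k, Represents (φ k) (v k)) ∧ (∀ k, f k =ᵐ[(surf d).restrict S] φ k) ∧
      Filter.Tendsto v Filter.atTop (𝓝 u) ∧ Filter.Tendsto f Filter.atTop (𝓝 g) := by
  have h' : (u, g) ∈ closure (smoothTraceGraph U S : Set (H1 U × L2Surf S)) := h
  obtain ⟨p, hp, hlim⟩ := mem_closure_iff_seq_limit.1 h'
  have hp' : ∀ k, ∃ φ : E d → E d, ContDiff ℝ ∞ φ ∧ HasCompactSupport φ ∧
      IsSmoothTrace φ (p k).1 (p k).2 := hp
  choose φ hφ hφc hφp using hp'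
  exact ⟨φ, fun k => (p k).1, fun k => (p k).2, hφ, hφc,
    fun k => ⟨(hφp k).1, (hφp k).2.1⟩, fun k => (hφp k).2.2,
    (continuous_fst.tendsto _).comp hlim, (continuous_snd.tendsto _).comp hlim⟩

/-- Multiplication by a cut-off function equal to `1` on `S` transfers a function with trace `g` on
`S` from one domain to another, with control of the norm. The product has trace zero wherever the
cut-off function vanishes. -/
theorem exists_hasTrace_cutoff {χ : E d → ℝ} (hχ : ContDiff ℝ ∞ χ) (hc : HasCompactSupport χ)
    {U₁ U₂ S S' : Set (E d)} (hU : ∀ x ∈ tsupport χ, x ∈ U₂ → x ∈ U₁) (hS : MeasurableSet S)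
    (hS1 : ∀ x ∈ S, χ x = 1) (hS' : MeasurableSet S') (hS0 : ∀ x ∈ S', χ x = 0) :
    ∃ C : ℝ, 0 < C ∧ ∀ (u : H1 U₁) (g : L2Surf S), HasTrace u g →
      ∃ w : H1 U₂, HasTrace w g ∧ HasTrace w (0 : L2Surf S') ∧ ‖w‖ ≤ C * ‖u‖ := by
  obtain ⟨C, hC⟩ := exists_norm_cutoff_le hχ hc hU
  refine ⟨C + 1, by positivity, fun u g hug => ?_⟩
  obtain ⟨φ, v, f, hφ, hφc, hrep, hf, hlim1, hlim2⟩ := hug.exists_seq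
  have hχφ : ∀ k, ContDiff ℝ ∞ fun x => χ x • φ k x := fun k => hχ.smul (hφ k)
  have hχφc : ∀ k, HasCompactSupport fun x => χ x • φ k x := fun k =>
    HasCompactSupport.smul_left (f := χ) (f' := φ k) (hφc k)
  choose w hw using fun k => exists_represents U₂ (hχφ k) (hχφc k)
  have hdist : ∀ k l, dist (w k) (w l) ≤ C * dist (v k) (v l) := by
    intro k l
    rw [dist_eq_norm, dist_eq_norm]
    refine hC (φ k - φ l) (v k - v l) (w k - w l) ((hφ k).sub (hφ l))
      ((hrep k).sub (hφ k) (hφ l) (hrep l)) ?_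
    have h : (fun x => χ x • (φ k - φ l) x) =
        (fun x => χ x • φ k x) - fun x => χ x • φ l x := by
      ext1 x
      simp only [Pi.sub_apply, smul_sub]
    rw [h]
    exact (hw k).sub (hχφ k) (hχφ l) (hw l)
  have hcau : CauchySeq w := by
    have h1 := hlim1.cauchySeq
    rw [Metric.cauchySeq_iff] at h1 ⊢
    intro ε hε
    have hC1 : (0 : ℝ) < C + 1 := by positivity
    obtain ⟨N, hN⟩ := h1 (ε / (C + 1)) (by positivity)
    refine ⟨N, fun k hk l hl => (hdist k l).trans_lt ?_⟩
    have h2 := hN k hk l hl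
    rw [lt_div_iff₀ hC1] at h2
    nlinarith [dist_nonneg (x := (v k)) (y := (v l))]
  obtain ⟨w₀, hw₀⟩ := cauchySeq_tendsto_of_complete hcau
  refine ⟨w₀, ?_, ?_, ?_⟩
  · refine isClosed_hasTrace.mem_of_tendsto (hw₀.prodMk_nhds hlim2)
      (Filter.Eventually.of_forall fun k => ?_)
    refine (hw k).hasTrace (hχφ k) (hχφc k) ?_
    filter_upwards [hf k, ae_restrict_mem hS] with x hx hxS
    rw [hx, hS1 x hxS, one_smul]
  · refine isClosed_hasTrace.mem_of_tendsto
      (hw₀.prodMk_nhds (tendsto_const_nhds (x := (0 : L2Surf S'))))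
      (Filter.Eventually.of_forall fun k => ?_)
    refine (hw k).hasTrace (hχφ k) (hχφc k) ?_
    filter_upwards [Lp.coeFn_zero (E d) 2 ((surf d).restrict S'), ae_restrict_mem hS'] with x hx hxS
    rw [hx, hS0 x hxS, zero_smul, Pi.zero_apply]
  · have h1 : ‖w₀‖ ≤ C * ‖u‖ := le_of_tendsto_of_tendsto hw₀.norm (hlim1.norm.const_mul _)
      (Filter.Eventually.of_forall fun k => hC _ _ _ (hφ k) (hrep k) (hw k))
    nlinarith [norm_nonneg u]

end

section

variable {d : ℕ}

/-! ### The Dirichlet form -/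

/-- The gradient `(∂₁u, …, ∂_d u)` as a continuous linear map on `H¹`. -/
noncomputable def H1.gradVec (U : Set (E d)) : H1 U →L[ℝ] PiLp 2 (fun _ : Fin d => L2 U) :=
  (WithLp.sndL 2 ℝ (L2 U) (PiLp 2 (fun _ : Fin d => L2 U))).comp (H1 U).subtypeL

theorem dirichletForm_eq_inner {U : Set (E d)} (v w : H1 U) :
    dirichletForm v w = inner ℝ (H1.gradVec U v) (H1.gradVec U w) := by
  rw [dirichletForm_eq, PiLp.inner_apply]
  rfl

theorem dirichletForm_sub_left {U : Set (E d)} (u v w : H1 U) :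
    dirichletForm (u - v) w = dirichletForm u w - dirichletForm v w := by
  simp only [dirichletForm_eq_inner, map_sub, inner_sub_left]

theorem dirichletForm_comm {U : Set (E d)} (v w : H1 U) :
    dirichletForm v w = dirichletForm w v := by
  rw [dirichletForm_eq_inner, dirichletForm_eq_inner, real_inner_comm]

theorem sqrt_dirichletForm_self {U : Set (E d)} (v : H1 U) :
    Real.sqrt (dirichletForm v v) = ‖H1.gradVec U v‖ := by
  rw [dirichletForm_eq_inner, real_inner_self_eq_norm_sq, Real.sqrt_sq (norm_nonneg _)]

theorem H1.norm_gradVec_le {U : Set (E d)} (u : H1 U) : ‖H1.gradVec U u‖ ≤ ‖u‖ := by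
  refine le_of_sq_le_sq ?_ (norm_nonneg u)
  rw [H1.norm_sq, PiLp.norm_sq_eq_of_L2]
  exact le_add_of_nonneg_left (sq_nonneg _)

/-- The Lax–Milgram theorem for the form `⟪G v, G w⟫` on a closed subspace on which it is
coercive. -/
theorem exists_inner_map_eq {H F : Type*} [NormedAddCommGroup H] [InnerProductSpace ℝ H]
    [CompleteSpace H] [NormedAddCommGroup F] [InnerProductSpace ℝ F] (G : H →L[ℝ] F)
    {K : Submodule ℝ H} (hK : IsClosed (K : Set H)) {C : ℝ} (hC : 0 < C)
    (hcoer : ∀ u ∈ K, ‖u‖ ^ 2 ≤ C * inner ℝ (G u) (G u)) (l : K →ₗ[ℝ] ℝ)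
    {M : ℝ} (hl : ∀ w : K, |l w| ≤ M * ‖(w : H)‖) :
    ∃ v ∈ K, ∀ w : K, inner ℝ (G v) (G w) = l w := by
  have : CompleteSpace K := hK.completeSpace_coe
  let B : K →L[ℝ] K →L[ℝ] ℝ := (innerSL ℝ).bilinearComp (G.comp K.subtypeL) (G.comp K.subtypeL)
  have hB : ∀ v w : K, B v w = inner ℝ (G v) (G w) := fun v w => rfl
  have hcoe : IsCoercive B := by
    refine ⟨C⁻¹, inv_pos.2 hC, fun u => ?_⟩
    rw [hB, mul_assoc, inv_mul_le_iff₀ hC, ← sq]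
    exact hcoer u u.2
  refine ⟨hcoe.continuousLinearEquivOfBilin.symm
    ((InnerProductSpace.toDual ℝ K).symm (l.mkContinuous M hl)),
    Subtype.property _, fun w => ?_⟩
  rw [← hB, ← hcoe.continuousLinearEquivOfBilin_apply, ContinuousLinearEquiv.apply_symm_apply,
    InnerProductSpace.toDual_symm_apply]
  rfl

theorem HasTrace.add {U S : Set (E d)} {u v : H1 U} {g h : L2Surf S} (hu : HasTrace u g)
    (hv : HasTrace v h) : HasTrace (u + v) (g + h) := (traceGraph U S).add_mem hu hv

theorem HasTrace.sub {U S : Set (E d)} {u v : H1 U} {g h : L2Surf S} (hu : HasTrace u g)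
    (hv : HasTrace v h) : HasTrace (u - v) (g - h) := (traceGraph U S).sub_mem hu hv

theorem HasTrace.smul {U S : Set (E d)} {u : H1 U} {g : L2Surf S} (c : ℝ) (hu : HasTrace u g) :
    HasTrace (c • u) (c • g) := (traceGraph U S).smul_mem c hu

theorem HasTrace.zero {U S : Set (E d)} : HasTrace (0 : H1 U) (0 : L2Surf S) :=
  (traceGraph U S).zero_mem

theorem HasTrace.of_tendsto {U S : Set (E d)} {u : ℕ → H1 U} {v : H1 U} {g : ℕ → L2Surf S}
    {h : L2Surf S} (hu : Filter.Tendsto u Filter.atTop (𝓝 v))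
    (hg : Filter.Tendsto g Filter.atTop (𝓝 h)) (ht : ∀ k, HasTrace (u k) (g k)) : HasTrace v h :=
  isClosed_hasTrace.mem_of_tendsto (hu.prodMk_nhds hg) (Filter.Eventually.of_forall ht)

/-- The functions in `H¹` with zero trace on `S`. -/
noncomputable def zeroTrace (U S : Set (E d)) : Submodule ℝ (H1 U) where
  carrier := {u | HasTrace u (0 : L2Surf S)}
  zero_mem' := HasTrace.zero
  add_mem' := fun hu hv => by simpa using HasTrace.add hu hv
  smul_mem' := fun c _ hu => by simpa using HasTrace.smul c hu

theorem mem_zeroTrace {U S : Set (E d)} {u : H1 U} :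
    u ∈ zeroTrace U S ↔ HasTrace u (0 : L2Surf S) := Iff.rfl

theorem isClosed_zeroTrace (U S : Set (E d)) : IsClosed (zeroTrace U S : Set (H1 U)) :=
  isClosed_hasTrace.preimage (f := fun u : H1 U => (u, (0 : L2Surf S))) (by fun_prop)

theorem HHalf.toL2_injective {Ω : Set (E d)} : Function.Injective (HHalf.toL2 (Ω := Ω)) :=
  Subtype.val_injective

/-! ### The Dirichlet problem in the annular region -/

/-- The analytic facts on which the theory of the Dirichlet-to-Neumann map rests: the
Poincaré inequality, the trace inequality on `∂Ω`, and the bounded passage between functions on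
`Ω` and functions on `Ω \ closure B` vanishing on `∂B` with the same trace on `∂Ω`. -/
structure AnnularEstimates (Ω B : Set (E d)) : Prop where
  coercive : ∃ C : ℝ, 0 < C ∧ ∀ u : H1 (annular Ω B), HasTrace u (0 : L2Surf (frontier B)) →
    ‖u‖ ^ 2 ≤ C * dirichletForm u u
  trace_le : ∃ C : ℝ, 0 ≤ C ∧ ∀ (u : H1 (annular Ω B)) (g : L2Surf (frontier Ω)),
    HasTrace u g → ‖g‖ ^ 2 ≤ C * ‖u‖ ^ 2
  restrict : ∃ C : ℝ, 0 < C ∧ ∀ (u : H1 Ω) (g : L2Surf (frontier Ω)), HasTrace u g →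
    ∃ w : H1 (annular Ω B), HasTrace w g ∧ HasTrace w (0 : L2Surf (frontier B)) ∧ ‖w‖ ≤ C * ‖u‖
  extend : ∃ C : ℝ, 0 < C ∧ ∀ (v : H1 (annular Ω B)) (g : L2Surf (frontier Ω)), HasTrace v g →
    ∃ u : H1 Ω, HasTrace u g ∧ ‖u‖ ≤ C * ‖v‖

theorem annularEstimates {Ω B : Set (E d)} (hΩ : IsOpen Ω) (hΩc : IsConnected Ω)
    (hΩb : Bornology.IsBounded Ω) (hΩL : HasLipschitzBoundary Ω) (hB : IsOpen B)
    (hBne : B.Nonempty) (hBL : HasLipschitzBoundary B) (hBΩ : closure B ⊆ Ω) :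
    AnnularEstimates Ω B := by
  have hcompact : IsCompact (frontier Ω) :=
    hΩb.isCompact_closure.of_isClosed_subset isClosed_frontier frontier_subset_closure
  obtain ⟨χ, hχ, hχc, hχ1, hχ0⟩ := exists_cutoff (isClosed_closure (s := B)) hcompact
    (disjoint_left.2 fun x hxB hxΩ => (hΩ.frontier_eq ▸ hxΩ).2 (hBΩ hxB))
  have hχB : ∀ x ∈ frontier B, χ x = 0 := fun x hx =>
    image_eq_zero_of_notMem_tsupport (hχ0 x (frontier_subset_closure hx))
  have hmS : MeasurableSet (frontier Ω) := isClosed_frontier.measurableSet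
  have hmB : MeasurableSet (frontier B) := isClosed_frontier.measurableSet
  refine ⟨exists_norm_sq_le_dirichletForm hΩ hΩc hΩb hΩL hB hBne hBL hBΩ,
    exists_norm_trace_le hΩ hΩb hΩL isClosed_closure hBΩ,
    exists_hasTrace_cutoff hχ hχc (fun x _ hx => hx.1) hmS hχ1 hmB hχB, ?_⟩
  obtain ⟨C, hC, h⟩ := exists_hasTrace_cutoff (U₁ := annular Ω B) (U₂ := Ω) hχ hχc
    (fun x hx hxΩ => ⟨hxΩ, fun hxB => hχ0 x hxB hx⟩) hmS hχ1 hmB hχB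
  refine ⟨C, hC, fun v g hvg => ?_⟩
  obtain ⟨u, hu, -, hle⟩ := h v g hvg
  exact ⟨u, hu, hle⟩

namespace AnnularEstimates

variable {Ω B : Set (E d)}

theorem eq_zero_of_dirichletForm_le (H : AnnularEstimates Ω B) {u : H1 (annular Ω B)}
    (hu : HasTrace u (0 : L2Surf (frontier B))) (h0 : dirichletForm u u ≤ 0) : u = 0 := by
  obtain ⟨C, hC, h⟩ := H.coercive
  have h1 : ‖u‖ ^ 2 ≤ 0 := (h u hu).trans (mul_nonpos_of_nonneg_of_nonpos hC.le h0)
  exact norm_eq_zero.1 (pow_eq_zero_iff two_ne_zero |>.1 (le_antisymm h1 (sq_nonneg _)))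

/-- The Dirichlet problem is solved by correcting a function `w` with the given traces by the
element `z` of the space of functions with zero traces that has the same energy products as `w`. -/
theorem existsUnique_solution (H : AnnularEstimates Ω B) (g : HHalf Ω) :
    ∃! v : H1 (annular Ω B), IsDirichletSolution g v := by
  obtain ⟨C, hC, hcoer⟩ := H.coercive
  obtain ⟨C', -, hrestrict⟩ := H.restrict
  obtain ⟨u, hu⟩ := g.exists_lift
  obtain ⟨w, hwg, hw0, -⟩ := hrestrict u _ hu
  let V : Submodule ℝ (H1 (annular Ω B)) :=
    zeroTrace (annular Ω B) (frontier B) ⊓ zeroTrace (annular Ω B) (frontier Ω)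
  have hV : IsClosed (V : Set (H1 (annular Ω B))) :=
    (isClosed_zeroTrace _ _).inter (isClosed_zeroTrace _ _)
  have hcoer' : ∀ u ∈ V,
      ‖u‖ ^ 2 ≤ C * inner ℝ (H1.gradVec (annular Ω B) u) (H1.gradVec (annular Ω B) u) := by
    intro u hu
    rw [← dirichletForm_eq_inner]
    exact hcoer u hu.1
  let l : H1 (annular Ω B) →L[ℝ] ℝ := (innerSL ℝ (H1.gradVec _ w)).comp (H1.gradVec _)
  obtain ⟨z, hzV, hz⟩ := exists_inner_map_eq (H := H1 (annular Ω B))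
    (H1.gradVec (annular Ω B)) hV hC hcoer' (l.toLinearMap.domRestrict V) fun u => l.le_opNorm u
  have horth : ∀ φ ∈ V, dirichletForm (w - z) φ = 0 := by
    intro φ hφ
    have h1 : inner ℝ (H1.gradVec _ z) (H1.gradVec _ φ) =
        inner ℝ (H1.gradVec _ w) (H1.gradVec _ φ) := hz ⟨φ, hφ⟩
    rw [dirichletForm_sub_left, dirichletForm_eq_inner, dirichletForm_eq_inner, h1, sub_self]
  have h0 : HasTrace (w - z) (0 : L2Surf (frontier B)) := by
    simpa using hw0.sub (mem_zeroTrace.1 hzV.1)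
  have h1 : HasTrace (w - z) g.toL2 := by
    simpa using hwg.sub (mem_zeroTrace.1 hzV.2)
  refine ⟨w - z, ⟨h0, h1, fun φ hφ0 hφ1 => horth φ ⟨hφ0, hφ1⟩⟩, fun v hv => ?_⟩
  have hd0 : HasTrace (v - (w - z)) (0 : L2Surf (frontier B)) := by
    simpa using hv.1.sub h0
  have hd1 : HasTrace (v - (w - z)) (0 : L2Surf (frontier Ω)) := by
    simpa using hv.2.1.sub h1
  refine sub_eq_zero.1 (H.eq_zero_of_dirichletForm_le hd0 (le_of_eq ?_))
  rw [dirichletForm_sub_left, hv.2.2 _ hd0 hd1, horth _ ⟨hd0, hd1⟩, sub_zero]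

end AnnularEstimates

end

section

variable {d : ℕ}

variable {Ω B : Set (E d)}

/-- The energy of a solution against any function vanishing on `∂B` depends only on the boundary
values of that function on `∂Ω`. -/
theorem IsDirichletSolution.dirichletForm_congr {g : HHalf Ω} {v : H1 (annular Ω B)}
    (hv : IsDirichletSolution g v) {w w' : H1 (annular Ω B)} {h : L2Surf (frontier Ω)}
    (hw : HasTrace w (0 : L2Surf (frontier B))) (hwh : HasTrace w h)
    (hw' : HasTrace w' (0 : L2Surf (frontier B))) (hwh' : HasTrace w' h) :
    dirichletForm v w = dirichletForm v w' := by
  have h1 := hv.2.2 (w - w') (by simpa using hw.sub hw') (by simpa using hwh.sub hwh')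
  rw [dirichletForm_comm, dirichletForm_sub_left, sub_eq_zero] at h1
  rw [dirichletForm_comm, h1, dirichletForm_comm]

theorem IsDirichletSolution.add {g h : HHalf Ω} {v w : H1 (annular Ω B)}
    (hv : IsDirichletSolution g v) (hw : IsDirichletSolution h w) :
    IsDirichletSolution (g + h) (v + w) := by
  refine ⟨by simpa using hv.1.add hw.1, hv.2.1.add hw.2.1, fun φ h0 h1 => ?_⟩
  have e1 := hv.2.2 φ h0 h1
  have e2 := hw.2.2 φ h0 h1
  rw [dirichletForm_eq_inner] at e1 e2 ⊢
  rw [map_add, inner_add_left, e1, e2, add_zero]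

theorem IsDirichletSolution.smul {g : HHalf Ω} {v : H1 (annular Ω B)} (c : ℝ)
    (hv : IsDirichletSolution g v) : IsDirichletSolution (c • g) (c • v) := by
  refine ⟨by simpa using hv.1.smul c, hv.2.1.smul c, fun φ h0 h1 => ?_⟩
  have e1 := hv.2.2 φ h0 h1
  rw [dirichletForm_eq_inner] at e1 ⊢
  rw [map_smul, inner_smul_left, e1, mul_zero]

namespace AnnularEstimates

/-- The solution operator `g ↦ v(g)` of the Dirichlet problem. -/
noncomputable def solution (H : AnnularEstimates Ω B) : HHalf Ω →ₗ[ℝ] H1 (annular Ω B) where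
  toFun g := (H.existsUnique_solution g).exists.choose
  map_add' g h := (H.existsUnique_solution (g + h)).unique
    (H.existsUnique_solution (g + h)).exists.choose_spec
    ((H.existsUnique_solution g).exists.choose_spec.add
      (H.existsUnique_solution h).exists.choose_spec)
  map_smul' c g := (H.existsUnique_solution (c • g)).unique
    (H.existsUnique_solution (c • g)).exists.choose_spec
    ((H.existsUnique_solution g).exists.choose_spec.smul c)

theorem isDirichletSolution_solution (H : AnnularEstimates Ω B) (g : HHalf Ω) :
    IsDirichletSolution g (H.solution g) := (H.existsUnique_solution g).exists.choose_spec

/-- The solution minimizes the energy among functions with the same boundary values. -/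
theorem norm_gradVec_solution_le (H : AnnularEstimates Ω B) {g : HHalf Ω}
    {w : H1 (annular Ω B)} (hw : HasTrace w (0 : L2Surf (frontier B)))
    (hwg : HasTrace w g.toL2) : ‖H1.gradVec _ (H.solution g)‖ ≤ ‖H1.gradVec _ w‖ := by
  have hs := H.isDirichletSolution_solution g
  have h1 := hs.dirichletForm_congr hs.1 hs.2.1 hw hwg
  rw [dirichletForm_eq_inner, dirichletForm_eq_inner, real_inner_self_eq_norm_sq] at h1
  have h2 := real_inner_le_norm (H1.gradVec _ (H.solution g)) (H1.gradVec _ w)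
  rw [← h1, sq] at h2
  by_contra! hlt
  have h3 : 0 < ‖H1.gradVec _ (H.solution g)‖ := (norm_nonneg _).trans_lt hlt
  exact absurd (le_of_mul_le_mul_left h2 h3) (not_le.2 hlt)

/-- The energy of the solution is bounded by the `H^{1/2}` norm of the datum. -/
theorem exists_norm_gradVec_solution_le (H : AnnularEstimates Ω B) :
    ∃ C : ℝ, 0 < C ∧ ∀ g : HHalf Ω, ‖H1.gradVec _ (H.solution g)‖ ≤ C * ‖g‖ := by
  obtain ⟨C, hC, h⟩ := H.restrict
  refine ⟨C, hC, fun g => ?_⟩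
  rw [← div_le_iff₀' hC]
  refine le_of_forall_gt_imp_ge_of_dense fun r hr => ?_
  obtain ⟨u, hu, hur⟩ := g.exists_lt hr
  obtain ⟨w, hwg, hw0, hle⟩ := h u _ hu
  rw [div_le_iff₀' hC]
  exact (H.norm_gradVec_solution_le hw0 hwg).trans ((H1.norm_gradVec_le w).trans
    (hle.trans (mul_le_mul_of_nonneg_left hur.le hC.le)))

/-- The `H^{1/2}` norm of the datum is bounded by the energy of the solution. -/
theorem exists_norm_le_norm_gradVec_solution (H : AnnularEstimates Ω B) :
    ∃ C : ℝ, 0 < C ∧ ∀ g : HHalf Ω, ‖g‖ ≤ C * ‖H1.gradVec _ (H.solution g)‖ := by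
  obtain ⟨C, hC, h⟩ := H.extend
  obtain ⟨C', hC', h'⟩ := H.coercive
  refine ⟨C * Real.sqrt C', by positivity, fun g => ?_⟩
  have hs := H.isDirichletSolution_solution g
  obtain ⟨u, hu, hle⟩ := h _ _ hs.2.1
  refine (HHalf.norm_le_of_hasTrace hu).trans (hle.trans ?_)
  rw [mul_assoc]
  refine mul_le_mul_of_nonneg_left ?_ hC.le
  rw [← sqrt_dirichletForm_self, ← Real.sqrt_mul hC'.le]
  exact Real.le_sqrt_of_sq_le (h' _ hs.1)

theorem exists_HHalf (H : AnnularEstimates Ω B) {v : H1 (annular Ω B)}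
    {g : L2Surf (frontier Ω)} (hv : HasTrace v g) : ∃ g' : HHalf Ω, g'.toL2 = g := by
  obtain ⟨C, -, h⟩ := H.extend
  obtain ⟨u, hu, -⟩ := h v g hv
  exact ⟨⟨g, ⟨(u, g), hu, rfl⟩⟩, rfl⟩

theorem solution_ne_zero (H : AnnularEstimates Ω B) {g : HHalf Ω} (hg : g ≠ 0) :
    H.solution g ≠ 0 := by
  intro h0
  obtain ⟨C, -, h⟩ := H.trace_le
  have h1 := h _ _ (H.isDirichletSolution_solution g).2.1
  rw [h0, norm_zero, zero_pow two_ne_zero, mul_zero] at h1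
  have h2 : g.toL2 = 0 :=
    norm_eq_zero.1 (pow_eq_zero_iff two_ne_zero |>.1 (le_antisymm h1 (sq_nonneg _)))
  exact hg (HHalf.toL2_injective h2)

/-- The solutions form a closed subspace of `H¹`: this is where the trace inequality guarantees
that a limit of solutions has a trace on `∂Ω`. -/
theorem isClosed_range_solution (H : AnnularEstimates Ω B) :
    IsClosed (LinearMap.range H.solution : Set (H1 (annular Ω B))) := by
  obtain ⟨C, hC, htr⟩ := H.trace_le
  refine IsSeqClosed.isClosed fun v v₀ hv hlim => ?_
  choose g hg using hv
  have hs : ∀ k, IsDirichletSolution (g k) (v k) := fun k => by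
    rw [← hg k]
    exact H.isDirichletSolution_solution (g k)
  have hle : ∀ k l, dist (g k).toL2 (g l).toL2 ≤ Real.sqrt C * dist (v k) (v l) := by
    intro k l
    rw [dist_eq_norm, dist_eq_norm]
    refine le_of_sq_le_sq ?_ (by positivity)
    rw [mul_pow, Real.sq_sqrt hC]
    exact htr _ _ ((hs k).2.1.sub (hs l).2.1)
  have hcau : CauchySeq fun k => (g k).toL2 := by
    have h1 := hlim.cauchySeq
    rw [Metric.cauchySeq_iff] at h1 ⊢
    intro ε hε
    have hC1 : (0 : ℝ) < Real.sqrt C + 1 := by positivity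
    obtain ⟨N, hN⟩ := h1 (ε / (Real.sqrt C + 1)) (by positivity)
    refine ⟨N, fun k hk l hl => (hle k l).trans_lt ?_⟩
    have h2 := hN k hk l hl
    rw [lt_div_iff₀ hC1] at h2
    nlinarith [dist_nonneg (x := v k) (y := v l)]
  obtain ⟨f, hf⟩ := cauchySeq_tendsto_of_complete hcau
  obtain ⟨g₀, rfl⟩ := H.exists_HHalf (HasTrace.of_tendsto hlim hf fun k => (hs k).2.1)
  have h0 : IsDirichletSolution g₀ v₀ := by
    refine ⟨HasTrace.of_tendsto hlim tendsto_const_nhds fun k => (hs k).1,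
      HasTrace.of_tendsto hlim hf fun k => (hs k).2.1, fun φ h1 h2 => ?_⟩
    have hcont : Continuous fun u : H1 (annular Ω B) => dirichletForm u φ := by
      simp only [dirichletForm_eq_inner]
      fun_prop
    refine tendsto_nhds_unique ((hcont.tendsto v₀).comp hlim) ?_
    refine tendsto_const_nhds.congr fun k => ?_
    exact ((hs k).2.2 φ h1 h2).symm
  exact ⟨g₀, (H.existsUnique_solution g₀).unique (H.isDirichletSolution_solution g₀) h0⟩

/-- Every functional on `H^{1/2}` is the weak normal derivative of a solution. -/
theorem exists_dirichletForm_solution_eq (H : AnnularEstimates Ω B) (l : HMinusHalf Ω) :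
    ∃ g : HHalf Ω, ∀ h : HHalf Ω, dirichletForm (H.solution g) (H.solution h) = l h := by
  obtain ⟨C, hC, hcoer⟩ := H.coercive
  obtain ⟨C', hC', hle⟩ := H.exists_norm_le_norm_gradVec_solution
  have hinj : Function.Injective H.solution :=
    (injective_iff_map_eq_zero H.solution).2 fun g hg => by
      by_contra hne
      exact H.solution_ne_zero hne hg
  let e := LinearEquiv.ofInjective H.solution hinj
  have hcoer' : ∀ u ∈ LinearMap.range H.solution,
      ‖u‖ ^ 2 ≤ C * inner ℝ (H1.gradVec (annular Ω B) u) (H1.gradVec (annular Ω B) u) := by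
    rintro _ ⟨g, rfl⟩
    rw [← dirichletForm_eq_inner]
    exact hcoer _ (H.isDirichletSolution_solution g).1
  have hbound : ∀ w : LinearMap.range H.solution,
      |(l.toLinearMap.comp e.symm.toLinearMap) w| ≤
        ‖l‖ * C' * ‖(w : H1 (annular Ω B))‖ := by
    intro w
    obtain ⟨g, rfl⟩ := e.surjective w
    have h1 : (l.toLinearMap.comp e.symm.toLinearMap) (e g) = l g := by simp
    rw [h1, mul_assoc]
    refine (l.le_opNorm g).trans (mul_le_mul_of_nonneg_left ?_ (norm_nonneg _))
    exact (hle g).trans (mul_le_mul_of_nonneg_left (H1.norm_gradVec_le _) hC'.le)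
  obtain ⟨v, ⟨g, rfl⟩, hv⟩ := exists_inner_map_eq (H := H1 (annular Ω B))
    (H1.gradVec (annular Ω B)) H.isClosed_range_solution hC hcoer' _ hbound
  refine ⟨g, fun h => ?_⟩
  have h1 := hv (e h)
  have h2 : (l.toLinearMap.comp e.symm.toLinearMap) (e h) = l h := by simp
  rw [h2] at h1
  rw [dirichletForm_eq_inner]
  exact h1

theorem abs_dirichletForm_solution_le (H : AnnularEstimates Ω B) (g h : HHalf Ω) :
    |dirichletForm (H.solution g) (H.solution h)| ≤
      ‖H1.gradVec _ (H.solution g)‖ * ‖H1.gradVec _ (H.solution h)‖ := by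
  rw [dirichletForm_eq_inner]
  exact abs_real_inner_le_norm _ _

/-! ### The Dirichlet-to-Neumann map -/

/-- A map is the Dirichlet-to-Neumann map exactly when it is given by the energy inner product of
solutions. -/
theorem isDirichletToNeumann_iff (H : AnnularEstimates Ω B) (Λ : HHalf Ω → HMinusHalf Ω) :
    IsDirichletToNeumann Ω B Λ ↔
      ∀ g h, Λ g h = dirichletForm (H.solution g) (H.solution h) := by
  constructor
  · intro hΛ g h
    have hs := H.isDirichletSolution_solution h
    exact hΛ g _ (H.isDirichletSolution_solution g) h _ hs.1 hs.2.1
  · intro hΛ g v hv h w hw hwh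
    have hs := H.isDirichletSolution_solution h
    rw [hΛ, (H.existsUnique_solution g).unique (H.isDirichletSolution_solution g) hv]
    exact hv.dirichletForm_congr hs.1 hs.2.1 hw hwh

theorem exists_isDirichletToNeumann (H : AnnularEstimates Ω B) :
    ∃ Λ : HHalf Ω → HMinusHalf Ω, IsDirichletToNeumann Ω B Λ := by
  obtain ⟨C, -, hC⟩ := H.exists_norm_gradVec_solution_le
  have hΛ : ∀ g : HHalf Ω, ∃ l : HMinusHalf Ω, ∀ h,
      l h = dirichletForm (H.solution g) (H.solution h) := by
    intro g
    let f : HHalf Ω →ₗ[ℝ] ℝ :=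
      ((innerSL ℝ (H1.gradVec _ (H.solution g))).comp (H1.gradVec _)).toLinearMap.comp H.solution
    have hf : ∀ h, f h = dirichletForm (H.solution g) (H.solution h) := fun h => by
      rw [dirichletForm_eq_inner]
      rfl
    refine ⟨f.mkContinuous (‖H1.gradVec _ (H.solution g)‖ * C) fun h => ?_, hf⟩
    rw [hf, mul_assoc]
    exact (H.abs_dirichletForm_solution_le g h).trans
      (mul_le_mul_of_nonneg_left (hC h) (norm_nonneg _))
  choose Λ hΛ using hΛ
  exact ⟨Λ, (H.isDirichletToNeumann_iff Λ).2 hΛ⟩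

end AnnularEstimates

end

end DtN

theorem mainTheorem3 {d : ℕ} (hd : d = 2 ∨ d = 3) (Ω B : Set (DtN.E d))
    (hΩ : IsOpen Ω) (hΩc : IsConnected Ω) (hΩb : Bornology.IsBounded Ω)
    (hΩL : DtN.HasLipschitzBoundary Ω)
    (hB : IsOpen B) (hBc : IsConnected B) (hBL : DtN.HasLipschitzBoundary B)
    (hBΩ : closure B ⊆ Ω) :
    (∀ g : DtN.HHalf Ω, ∃! v : DtN.H1 (DtN.annular Ω B), DtN.IsDirichletSolution g v) ∧
    (∃! Λ : DtN.HHalf Ω → DtN.HMinusHalf Ω, DtN.IsDirichletToNeumann Ω B Λ) ∧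
    ∀ Λ : DtN.HHalf Ω → DtN.HMinusHalf Ω, DtN.IsDirichletToNeumann Ω B Λ →
      IsLinearMap ℝ Λ ∧
      (∀ g₁ g₂ : DtN.HHalf Ω, Λ g₁ g₂ = Λ g₂ g₁) ∧
      (∀ g : DtN.HHalf Ω, g ≠ 0 → 0 < Λ g g) ∧
      (∃ c C : ℝ, 0 < c ∧ 0 < C ∧ ∀ g : DtN.HHalf Ω,
        c * ‖g‖ ≤ Real.sqrt (Λ g g) ∧ Real.sqrt (Λ g g) ≤ C * ‖g‖) ∧
      ∃ e : DtN.HHalf Ω ≃L[ℝ] DtN.HMinusHalf Ω, ∀ g : DtN.HHalf Ω, e g = Λ g := by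
  have H := DtN.annularEstimates hΩ hΩc hΩb hΩL hB hBc.nonempty hBL hBΩ
  refine ⟨H.existsUnique_solution, ?_, fun Λ hΛ => ?_⟩
  · obtain ⟨Λ, hΛ⟩ := H.exists_isDirichletToNeumann
    refine ⟨Λ, hΛ, fun Λ' hΛ' => ?_⟩
    rw [H.isDirichletToNeumann_iff] at hΛ
    have hΛ'' := (H.isDirichletToNeumann_iff Λ').1 hΛ'
    funext g
    ext h
    rw [hΛ, hΛ'']
  rw [H.isDirichletToNeumann_iff] at hΛ
  obtain ⟨C₁, hC₁, hupper⟩ := H.exists_norm_gradVec_solution_le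
  obtain ⟨C₂, hC₂, hlower⟩ := H.exists_norm_le_norm_gradVec_solution
  have hlin : IsLinearMap ℝ Λ := by
    refine ⟨fun g h => ?_, fun c g => ?_⟩
    · ext k
      simp only [add_apply, hΛ, DtN.dirichletForm_eq_inner, map_add,
        inner_add_left]
    · ext k
      simp only [smul_apply, hΛ, DtN.dirichletForm_eq_inner, map_smul,
        inner_smul_left, smul_eq_mul]
      rfl
  have hpos : ∀ g : DtN.HHalf Ω, g ≠ 0 → 0 < Λ g g := by
    intro g hg
    by_contra! hle
    rw [hΛ] at hle
    exact H.solution_ne_zero hg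
      (H.eq_zero_of_dirichletForm_le (H.isDirichletSolution_solution g).1 hle)
  have hsqrt : ∀ g, Real.sqrt (Λ g g) = ‖DtN.H1.gradVec _ (H.solution g)‖ := fun g => by
    rw [hΛ, DtN.sqrt_dirichletForm_self]
  refine ⟨hlin, fun g h => ?_, hpos, ⟨C₂⁻¹, C₁, inv_pos.2 hC₂, hC₁, fun g => ?_⟩, ?_⟩
  · rw [hΛ, hΛ, DtN.dirichletForm_comm]
  · rw [hsqrt, inv_mul_le_iff₀ hC₂]
    exact ⟨hlower g, hupper g⟩
  let L : DtN.HHalf Ω →ₗ[ℝ] DtN.HMinusHalf Ω := hlin.mk' Λ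
  have hbij : Function.Bijective L := by
    refine ⟨(injective_iff_map_eq_zero L).2 fun g hg => ?_, fun l => ?_⟩
    · by_contra hne
      have h1 : Λ g = 0 := hg
      have h2 := hpos g hne
      rw [h1] at h2
      exact lt_irrefl _ h2
    · obtain ⟨g, hg⟩ := H.exists_dirichletForm_solution_eq l
      refine ⟨g, ?_⟩
      ext h
      exact (hΛ g h).trans (hg h)
  have hto : ∀ g, ‖Λ g‖ ≤ C₁ * C₁ * ‖g‖ := by
    intro g
    refine ContinuousLinearMap.opNorm_le_bound _ (by positivity) fun h => ?_
    rw [hΛ]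
    calc _ ≤ _ := H.abs_dirichletForm_solution_le g h
      _ ≤ (C₁ * ‖g‖) * (C₁ * ‖h‖) := by gcongr; exacts [hupper g, hupper h]
      _ = _ := by ring
  have hinv : ∀ g, ‖g‖ ≤ C₂ * C₂ * ‖Λ g‖ := by
    intro g
    -- The energy of `g` is `Λ g g`, hence at most `‖Λ g‖ ‖g‖`.
    have h1 : ‖g‖ * ‖g‖ ≤ C₂ * C₂ * ‖Λ g‖ * ‖g‖ := by
      have h2 : ‖DtN.H1.gradVec _ (H.solution g)‖ ^ 2 ≤ ‖Λ g‖ * ‖g‖ := by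
        rw [← real_inner_self_eq_norm_sq, ← DtN.dirichletForm_eq_inner, ← hΛ]
        exact (le_abs_self _).trans ((Λ g).le_opNorm g)
      calc ‖g‖ * ‖g‖ ≤ (C₂ * ‖DtN.H1.gradVec _ (H.solution g)‖) *
            (C₂ * ‖DtN.H1.gradVec _ (H.solution g)‖) := by gcongr <;> exact hlower g
        _ = C₂ * C₂ * ‖DtN.H1.gradVec _ (H.solution g)‖ ^ 2 := by ring
        _ ≤ C₂ * C₂ * (‖Λ g‖ * ‖g‖) := by gcongr
        _ = _ := by ring
    rcases (norm_nonneg g).eq_or_lt with h0 | h0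
    · rw [← h0]
      positivity
    · exact le_of_mul_le_mul_right h1 h0
  refine ⟨(LinearEquiv.ofBijective L hbij).toContinuousLinearEquivOfBounds (C₁ * C₁) (C₂ * C₂)
    hto fun l => ?_, fun g => rfl⟩
  have h1 := hinv ((LinearEquiv.ofBijective L hbij).symm l)
  have h2 : Λ ((LinearEquiv.ofBijective L hbij).symm l) = l :=
    (LinearEquiv.ofBijective L hbij).apply_symm_apply l
  rwa [h2] at h1
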